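/- Let $N$ be a von Neumann algebra on a Hilbert space $H$ and let $J\subseteq N$ be a norm closed two-sided ideal. Let $(\mathcal A,H,\mathcal D)$ be a von Neumann spectral triple relative to $(N,J)$: the $*$-algebra $\mathcal A$ is represented in $N$ (we write $a$ also for the operator that represents $a\in\mathcal A$), $\mathcal D$ is a self-adjoint operator on $H$ affiliated to $N$, for every $a\in\mathcal A$ the commutator $[\mathcal D,a]$ is defined on $\mathrm{Dom}(\mathcal D)$ and extends to a bounded operator, and $a(\lambda-\mathcal D)^{-1}\in J$ for all $a\in\mathcal A$ and $\lambda\in\mathbb C\setminus\mathbb R$. Assume that the triple is unital (the unit of $N$ lies in $\mathcal A$) and that the norm closure $A=\overline{\mathcal A}\subseteq\mathcal L(H)$ is a separable $C^*$-algebra. Put $F_{\mathcal D}=\mathcal D(1+\mathcal D^2)^{-1/2}$, and let $\mathcal B$ be the smallest $C^*$-algebra in $\mathcal L(H)$ containing the elements $$F_{\mathcal D}[F_{\mathcal D},a],\quad b[F_{\mathcal D},a],\quad F_{\mathcal D}b[F_{\mathcal D},a],\quad a\varphi(\mathcal D)\qquad (a,b\in\mathcal A,\ \varphi\in C_0(\mathbb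 R)).$$ Then $\mathcal B$ is separable, hence $\sigma$-unital, and $\mathcal B\subseteq J$. Moreover, regard $\mathcal B$ as a right Hilbert $\mathcal B$-module with $\langle x,y\rangle=x^*y$, and write $\mathcal L(\mathcal B)$ for its adjointable operators and $\mathcal K(\mathcal B)$ for its compact operators. Left multiplication defines a $*$-homomorphism $\mathcal M_A:A\to\mathcal L(\mathcal B)$ and an operator $F_{\mathcal D}\in\mathcal L(\mathcal B)$, and $(\mathcal M_A,F_{\mathcal D})$ is an (ungraded, i.e. odd) Kasparov $A$-$\mathcal B$-module: $\mathcal B$ is countably generated as a Hilbert module and, for all $a\in A$, the operators $\mathcal M_A(a)(F_{\mathcal D}^2-1)$, $\mathcal M_A(a)(F_{\mathcal D}-F_{\mathcal D}^*)$ and $[F_{\mathcal D},\mathcal M_A(a)]$ lie in $\mathcal K(\mathcal B)$. Consequently the $C^*$-spectral flow with values in $K_0(\mathcal B)$ is always defined: with $p_F=\frac12(F_{\mathcal D}+1)$, for every unitary $u\in\mathcal A$ the operator $p_Fup_F+1-p_F\in\mathcal L(\mathcal B)$ is unitary modulo $\mathcal K(\mathcal B)$, so it has a class in $K_1(\mathcal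 L(\mathcal B)/\mathcal K(\mathcal B))$ to which the boundary map into $K_0(\mathcal B)$ applies. -/

import Mathlib

noncomputable section

namespace UnboundedOperator

variable {H : Type*} [NormedAddCommGroup H] [InnerProductSpace ℂ H] [CompleteSpace H]
  {T : H →ₗ.[ℂ] H}

theorem symm_apply (hT : IsSelfAdjoint T) (x y : T.domain) :
    inner ℂ (T x) (y : H) = inner ℂ (x : H) (T y) := by
  have h := LinearPMap.adjoint_isFormalAdjoint hT.dense_domain
  rw [LinearPMap.isSelfAdjoint_def.mp hT] at h
  exact h x y

theorem norm_le_resolvent (hT : IsSelfAdjoint T) (z : ℂ) (x : T.domain) :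
    |z.im| * ‖(x : H)‖ ≤ ‖z • (x : H) - T x‖ := by
  have hreal : (inner ℂ (x : H) (T x)).im = 0 := by
    have h1 := symm_apply hT x x
    have h2 : (starRingEnd ℂ) (inner ℂ (x : H) (T x)) = inner ℂ (x : H) (T x) := by
      rw [inner_conj_symm, h1]
    exact Complex.conj_eq_iff_im.mp h2
  have him : (inner ℂ (x : H) (z • (x : H) - T x)).im = z.im * ‖(x : H)‖ ^ 2 := by
    rw [inner_sub_right, inner_smul_right, inner_self_eq_norm_sq_to_K, Complex.sub_im, hreal]
    simp [Complex.mul_im, ← Complex.ofReal_pow]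
  have h3 : |z.im| * ‖(x : H)‖ ^ 2 ≤ ‖(x : H)‖ * ‖z • (x : H) - T x‖ := by
    calc |z.im| * ‖(x : H)‖ ^ 2 = |(inner ℂ (x : H) (z • (x : H) - T x)).im| := by
          rw [him, abs_mul, abs_of_nonneg (by positivity : (0 : ℝ) ≤ ‖(x : H)‖ ^ 2)]
      _ ≤ ‖inner ℂ (x : H) (z • (x : H) - T x)‖ := Complex.abs_im_le_norm _
      _ ≤ _ := norm_inner_le_norm _ _
  rcases (norm_nonneg (x : H)).eq_or_lt with h0 | h0
  · rw [← h0]; simp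
  · nlinarith

theorem eq_zero_of_resolvent (hT : IsSelfAdjoint T) {z : ℂ} (hz : z.im ≠ 0) (x : T.domain)
    (h : z • (x : H) - T x = 0) : (x : H) = 0 := by
  have h1 := norm_le_resolvent hT z x
  rw [h, norm_zero] at h1
  have h2 : 0 < |z.im| := abs_pos.mpr hz
  have h3 : ‖(x : H)‖ = 0 := by nlinarith [norm_nonneg (x : H)]
  simpa using h3

theorem exists_resolvent (hT : IsSelfAdjoint T) {z : ℂ} (hz : z.im ≠ 0) :
    ∃ R : H →L[ℂ] H, ∀ x, ∃ h : R x ∈ T.domain, z • R x - T ⟨R x, h⟩ = x := by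
  have hb : 0 < |z.im| := abs_pos.mpr hz
  have hcl : IsClosed (T.graph : Set (H × H)) := hT.isClosed
  have : CompleteSpace T.graph := hcl.completeSpace_coe
  let L : T.graph →L[ℂ] H :=
    (z • ContinuousLinearMap.fst ℂ H H - ContinuousLinearMap.snd ℂ H H).comp T.graph.subtypeL
  have hL : ∀ p : T.graph, L p = z • p.1.1 - p.1.2 := fun p => rfl
  have hg : ∀ p : T.graph, ∃ x : T.domain, p.1.1 = x ∧ p.1.2 = T x := by
    rintro ⟨p, hp⟩
    obtain ⟨x, h1, h2⟩ := (LinearPMap.mem_graph_iff T).mp hp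
    exact ⟨x, h1.symm, h2.symm⟩
  have hlow : ∀ p : T.graph, ‖p‖ ≤ ((1 + ‖z‖) / |z.im| + 1) * ‖L p‖ := by
    intro p
    obtain ⟨x, h1, h2⟩ := hg p
    have hx := norm_le_resolvent hT z x
    rw [← h1, ← h2, ← hL] at hx
    have hx' : ‖p.1.1‖ ≤ ‖L p‖ / |z.im| := by
      rw [le_div_iff₀ hb]; linarith
    have h3 : ‖p.1.2‖ ≤ ‖z‖ * ‖p.1.1‖ + ‖L p‖ := by
      have : p.1.2 = z • p.1.1 - L p := by rw [hL]; abel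
      rw [this, ← norm_smul]
      exact norm_sub_le _ _
    have h4 : ‖z‖ * ‖p.1.1‖ ≤ ‖z‖ * (‖L p‖ / |z.im|) := by gcongr
    have h5 : ((1 + ‖z‖) / |z.im| + 1) * ‖L p‖
        = ‖L p‖ / |z.im| + ‖z‖ * (‖L p‖ / |z.im|) + ‖L p‖ := by ring
    have h6 : 0 ≤ ‖L p‖ / |z.im| := by positivity
    have h7 : 0 ≤ ‖z‖ * (‖L p‖ / |z.im|) := by positivity
    rw [h5]
    change max ‖p.1.1‖ ‖p.1.2‖ ≤ _
    apply max_le <;> linarith [norm_nonneg (L p)]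
  have hanti : AntilipschitzWith ((1 + ‖z‖) / |z.im| + 1).toNNReal L := by
    apply ContinuousLinearMap.antilipschitz_of_bound
    intro p
    rw [Real.coe_toNNReal _ (by positivity)]
    exact hlow p
  have hrc : IsClosed (Set.range L) := hanti.isClosed_range L.uniformContinuous
  have hrc' : IsClosed (L.range : Set H) := hrc
  have : CompleteSpace L.range := hrc'.completeSpace_coe
  have hsurj : L.range = ⊤ := by
    rw [← Submodule.orthogonal_eq_bot_iff, Submodule.eq_bot_iff]
    intro w hw
    have hw' : ∀ x : T.domain, inner ℂ ((starRingEnd ℂ z) • w) (x : H) = inner ℂ w (T x) := by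
      intro x
      have h1 := Submodule.inner_left_of_mem_orthogonal
        (LinearMap.mem_range_self (L : T.graph →ₗ[ℂ] H) ⟨_, T.mem_graph x⟩) hw
      change inner ℂ w (z • (x : H) - T x) = 0 at h1
      rw [inner_sub_right, sub_eq_zero, inner_smul_right] at h1
      rw [inner_smul_left, Complex.conj_conj, h1]
    have hmem : w ∈ T.adjoint.domain := LinearPMap.mem_adjoint_domain_of_exists w ⟨_, hw'⟩
    have hval := LinearPMap.adjoint_apply_eq hT.dense_domain ⟨w, hmem⟩ hw'
    have hgr : (w, (starRingEnd ℂ z) • w) ∈ T.adjoint.graph := by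
      rw [LinearPMap.mem_graph_iff]
      exact ⟨⟨w, hmem⟩, rfl, hval⟩
    rw [LinearPMap.isSelfAdjoint_def.mp hT, LinearPMap.mem_graph_iff] at hgr
    obtain ⟨x, h1, h2⟩ := hgr
    simp only at h1 h2
    have := eq_zero_of_resolvent hT (z := starRingEnd ℂ z) (by simpa using hz) x
      (by rw [h2, h1, sub_self])
    rw [← h1, this]
  have hinj : L.ker = ⊥ := by
    rw [LinearMap.ker_eq_bot]
    exact hanti.injective
  let e := ContinuousLinearEquiv.ofBijective L hinj hsurj
  refine ⟨(ContinuousLinearMap.fst ℂ H H).comp (T.graph.subtypeL.comp e.symm.toContinuousLinearMap),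
    fun y => ?_⟩
  obtain ⟨x, h1, h2⟩ := hg (e.symm y)
  have h3 : L (e.symm y) = y := ContinuousLinearEquiv.ofBijective_apply_symm_apply L hinj hsurj y
  rw [hL] at h3
  have hR : ((ContinuousLinearMap.fst ℂ H H).comp
    (T.graph.subtypeL.comp e.symm.toContinuousLinearMap)) y = (x : H) := h1
  have hm : ((ContinuousLinearMap.fst ℂ H H).comp
    (T.graph.subtypeL.comp e.symm.toContinuousLinearMap)) y ∈ T.domain := by
    rw [hR]; exact x.2
  refine ⟨hm, ?_⟩
  have h4 : T ⟨_, hm⟩ = T x := congrArg T (Subtype.ext hR)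
  rw [h4, hR, ← h2, ← h1, h3]

/-- The resolvent `(z - T)⁻¹` of a self-adjoint operator `T` at a non-real number `z`, as a bounded
operator on `H`. -/
def resolvent (hT : IsSelfAdjoint T) (z : ℂ) (hz : z.im ≠ 0) : H →L[ℂ] H :=
  (exists_resolvent hT hz).choose

theorem resolvent_mem (hT : IsSelfAdjoint T) {z : ℂ} (hz : z.im ≠ 0) (x : H) :
    resolvent hT z hz x ∈ T.domain :=
  ((exists_resolvent hT hz).choose_spec x).choose

theorem sub_resolvent (hT : IsSelfAdjoint T) {z : ℂ} (hz : z.im ≠ 0) (x : H) :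
    z • resolvent hT z hz x - T ⟨resolvent hT z hz x, resolvent_mem hT hz x⟩ = x :=
  ((exists_resolvent hT hz).choose_spec x).choose_spec

theorem resolvent_sub (hT : IsSelfAdjoint T) {z : ℂ} (hz : z.im ≠ 0) (x : T.domain) :
    resolvent hT z hz (z • (x : H) - T x) = x := by
  set y : H := z • (x : H) - T x with hy
  have h := sub_resolvent hT hz y
  have h2 := eq_zero_of_resolvent hT hz (⟨_, resolvent_mem hT hz y⟩ - x) (by
    rw [LinearPMap.map_sub]
    simp only [AddSubgroupClass.coe_sub, smul_sub]
    rw [sub_sub_sub_comm, h, ← hy, sub_self])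
  simpa [sub_eq_zero] using h2

theorem I_im_ne : Complex.I.im ≠ 0 := by simp

theorem neg_I_im_ne : (-Complex.I).im ≠ 0 := by simp

theorem adjoint_resolvent (hT : IsSelfAdjoint T) :
    star (resolvent hT Complex.I I_im_ne) = resolvent hT (-Complex.I) neg_I_im_ne := by
  symm
  rw [ContinuousLinearMap.star_eq_adjoint, ContinuousLinearMap.eq_adjoint_iff]
  intro x y
  have hx := sub_resolvent hT neg_I_im_ne x
  have hy := sub_resolvent hT I_im_ne y
  have hs := symm_apply hT ⟨_, resolvent_mem hT neg_I_im_ne x⟩ ⟨_, resolvent_mem hT I_im_ne y⟩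
  simp only at hs
  conv_lhs => rw [← hy]
  conv_rhs => rw [← hx]
  rw [inner_sub_left, inner_sub_right, hs, inner_smul_left, inner_smul_right]
  simp

/-- The bounded positive operator `(1 + T²)⁻¹ = (i - T)⁻¹ (-i - T)⁻¹`. -/
def invOneAddSq (hT : IsSelfAdjoint T) : H →L[ℂ] H :=
  resolvent hT Complex.I I_im_ne * resolvent hT (-Complex.I) neg_I_im_ne

theorem invOneAddSq_nonneg (hT : IsSelfAdjoint T) : 0 ≤ invOneAddSq hT := by
  rw [invOneAddSq, ← adjoint_resolvent hT]
  exact mul_star_self_nonneg _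

/-- The positive square root `(1 + T²)^(-1/2)`. -/
def invSqrtOneAddSq (hT : IsSelfAdjoint T) : H →L[ℂ] H := CFC.sqrt (invOneAddSq hT)

theorem resolvent_eq_zero (hT : IsSelfAdjoint T) {z : ℂ} (hz : z.im ≠ 0) (x : H)
    (h : resolvent hT z hz x = 0) : x = 0 := by
  have h1 := sub_resolvent hT hz x
  have h2 : T ⟨resolvent hT z hz x, resolvent_mem hT hz x⟩ = 0 := by
    have : (⟨resolvent hT z hz x, resolvent_mem hT hz x⟩ : T.domain) = 0 := Subtype.ext h
    rw [this, LinearPMap.map_zero]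
  rw [h2, h] at h1
  simpa using h1.symm

theorem exists_boundedTransform (hT : IsSelfAdjoint T) :
    ∃ F : H →L[ℂ] H, ∀ x, ∃ h : invSqrtOneAddSq hT x ∈ T.domain,
      F x = T ⟨invSqrtOneAddSq hT x, h⟩ := by
  set R := resolvent hT Complex.I I_im_ne with hR
  set R' := resolvent hT (-Complex.I) neg_I_im_ne with hR'
  set Q := invSqrtOneAddSq hT with hQ
  have hadj : star R = R' := adjoint_resolvent hT
  have hQQ : ∀ x, Q (Q x) = R (R' x) := fun x =>
    DFunLike.congr_fun (CFC.sqrt_mul_sqrt_self (invOneAddSq hT) (invOneAddSq_nonneg hT)) x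
  have hQs : IsSelfAdjoint Q := (CFC.sqrt_nonneg (invOneAddSq hT)).isSelfAdjoint
  have hQin : ∀ x y, inner ℂ (Q x) y = inner ℂ x (Q y) := fun x y => by
    have h := ContinuousLinearMap.adjoint_inner_left Q y x
    rwa [← ContinuousLinearMap.star_eq_adjoint, hQs.star_eq] at h
  let K : H →L[ℂ] H := Complex.I • (R * R') - R'
  have hK : ∀ y, T ⟨R (R' y), resolvent_mem hT _ _⟩ = K y := by
    intro y
    have h := sub_resolvent hT I_im_ne (R' y)
    change _ = Complex.I • R (R' y) - R' y
    rw [eq_sub_iff_add_eq, ← eq_sub_iff_add_eq', h]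
  have hgr : ∀ y, (Q (Q y), K y) ∈ T.graph := by
    intro y
    rw [LinearPMap.mem_graph_iff]
    exact ⟨⟨R (R' y), resolvent_mem hT _ _⟩, (hQQ y).symm, hK y⟩
  have hnorm : ∀ y, ‖K y‖ ≤ ‖Q y‖ := by
    intro y
    have h1 : (inner ℂ (R (R' y)) (K y)).im = 0 := by
      rw [← hK]
      have h1 := symm_apply hT ⟨R (R' y), resolvent_mem hT _ _⟩ ⟨R (R' y), resolvent_mem hT _ _⟩
      apply Complex.conj_eq_iff_im.mp
      rw [inner_conj_symm, h1]
    have h2 : R' y = Complex.I • R (R' y) - K y := by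
      change _ = _ - (Complex.I • R (R' y) - R' y)
      abel
    have h3 : ‖R' y‖ ^ 2 = ‖R (R' y)‖ ^ 2 + ‖K y‖ ^ 2 := by
      conv_lhs => rw [h2]
      rw [@norm_sub_sq ℂ, norm_smul, inner_smul_left]
      simp [h1]
    have h4 : ‖R' y‖ ^ 2 = ‖Q y‖ ^ 2 := by
      have h5 : (inner ℂ (R' y) (R' y) : ℂ) = inner ℂ (Q y) (Q y) := by
        rw [hQin, hQQ, ← hadj, ContinuousLinearMap.star_eq_adjoint,
          ContinuousLinearMap.adjoint_inner_left]
      rw [inner_self_eq_norm_sq_to_K, inner_self_eq_norm_sq_to_K] at h5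
      exact_mod_cast h5
    apply le_of_sq_le_sq _ (norm_nonneg _)
    nlinarith [sq_nonneg ‖R (R' y)‖]
  have hdense : DenseRange Q := by
    have hker : Q.rangeᗮ = ⊥ := by
      rw [Submodule.eq_bot_iff]
      intro w hw
      have h1 : Q w = 0 := by
        have h2 := Submodule.inner_left_of_mem_orthogonal
          (LinearMap.mem_range_self (Q : H →ₗ[ℂ] H) (Q w)) hw
        change inner ℂ w (Q (Q w)) = 0 at h2
        rw [← hQin] at h2
        exact inner_self_eq_zero.mp h2
      have h3 : R (R' w) = 0 := by rw [← hQQ, h1, map_zero]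
      exact resolvent_eq_zero hT _ _ (resolvent_eq_zero hT _ _ h3)
    have := (Submodule.topologicalClosure_eq_top_iff (K := Q.range)).mpr hker
    have h2 := Submodule.dense_iff_topologicalClosure_eq_top.mpr this
    exact h2
  let F : H →L[ℂ] H := (K : H →ₗ[ℂ] H).extendOfNorm (Q : H →ₗ[ℂ] H)
  have hF : ∀ y, F (Q y) = K y := fun y =>
    LinearMap.extendOfNorm_eq (f := (K : H →ₗ[ℂ] H)) (e := (Q : H →ₗ[ℂ] H)) hdense
      ⟨1, fun x => by simpa using hnorm x⟩ y
  have hcl : IsClosed (T.graph : Set (H × H)) := hT.isClosed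
  have hall : ∀ x, (Q x, F x) ∈ T.graph := by
    intro x
    have hc : IsClosed {x | (Q x, F x) ∈ T.graph} :=
      hcl.preimage (Q.continuous.prodMk F.continuous)
    refine hdense.induction_on (p := fun x => (Q x, F x) ∈ T.graph) x hc fun y => ?_
    rw [hF]
    exact hgr y
  refine ⟨F, fun x => ?_⟩
  obtain ⟨w, h1, h2⟩ := (LinearPMap.mem_graph_iff T).mp (hall x)
  simp only at h1 h2
  refine ⟨by rw [← h1]; exact w.2, ?_⟩
  rw [← h2]
  exact congrArg T (Subtype.ext h1)

/-- The bounded operator `F_T = T (1 + T²)^(-1/2)` of a self-adjoint operator `T`. -/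
def boundedTransform (hT : IsSelfAdjoint T) : H →L[ℂ] H := (exists_boundedTransform hT).choose

theorem invSqrtOneAddSq_mem (hT : IsSelfAdjoint T) (x : H) : invSqrtOneAddSq hT x ∈ T.domain :=
  ((exists_boundedTransform hT).choose_spec x).choose

theorem boundedTransform_apply (hT : IsSelfAdjoint T) (x : H) :
    boundedTransform hT x = T ⟨invSqrtOneAddSq hT x, invSqrtOneAddSq_mem hT x⟩ :=
  ((exists_boundedTransform hT).choose_spec x).choose_spec

/-- The functional calculus `φ ↦ φ(T)` of a self-adjoint operator `T` on `C₀(ℝ)`, obtained from the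
continuous functional calculus of the bounded normal operator `R = (i - T)⁻¹`: the spectrum of `R`
consists of points `z = 1 / (i - x)` with `x` in the spectrum of `T`, that is `x = -Re (1 / z)`, and
possibly of `z = 0`, which corresponds to `x = ∞`. -/
def c0Calculus (hT : IsSelfAdjoint T) (φ : ZeroAtInftyContinuousMap ℝ ℂ) : H →L[ℂ] H :=
  cfc (fun z : ℂ => if z = 0 then 0 else φ (-(z⁻¹).re)) (resolvent hT Complex.I I_im_ne)

end UnboundedOperator

/-- A right Hilbert C*-module `E` over a C*-algebra `B` (together with `CompleteSpace E`): the right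
action of `B` is the action of `Bᵐᵒᵖ`, the `B`-valued inner product is linear in the second
variable, and the norm of `E` is the one induced by it. -/
class RightHilbertModule (B E : Type*) [NonUnitalCStarAlgebra B] [NormedAddCommGroup E]
    [NormedSpace ℂ E] [SMul Bᵐᵒᵖ E] where
  /-- the `B`-valued inner product -/
  ip : E → E → B
  ip_add_right (x y z : E) : ip x (y + z) = ip x y + ip x z
  ip_smul_right (c : ℂ) (x y : E) : ip x (c • y) = c • ip x y
  ip_act_right (b : B) (x y : E) : ip x (MulOpposite.op b • y) = ip x y * b
  star_ip (x y : E) : star (ip x y) = ip y x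
  ip_self_nonneg (x : E) : ∃ b : B, ip x x = star b * b
  norm_sq_eq (x : E) : ‖x‖ ^ 2 = ‖ip x x‖

/-- A C*-algebra is a right Hilbert module over itself, with `⟨x, y⟩ = x* y`. -/
instance RightHilbertModule.self (B : Type*) [NonUnitalCStarAlgebra B] :
    RightHilbertModule B B where
  ip x y := star x * y
  ip_add_right x y z := mul_add _ _ _
  ip_smul_right c x y := mul_smul_comm _ _ _
  ip_act_right b x y := (mul_assoc _ _ _).symm
  star_ip x y := by simp
  ip_self_nonneg x := ⟨x, rfl⟩
  norm_sq_eq x := by rw [CStarRing.norm_star_mul_self, sq]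

namespace RightHilbertModule

section general

variable (B E : Type*) [NonUnitalCStarAlgebra B] [NormedAddCommGroup E]
  [NormedSpace ℂ E] [SMul Bᵐᵒᵖ E] [RightHilbertModule B E]

variable {B E} in
theorem ip_add_left (x y z : E) : (ip (x + y) z : B) = ip x z + ip y z := by
  rw [← star_ip, ip_add_right, star_add, star_ip, star_ip]

variable {B E} in
theorem ip_smul_left (c : ℂ) (x y : E) : (ip (c • x) y : B) = star c • ip x y := by
  rw [← star_ip, ip_smul_right, star_smul, star_ip]

variable {B E} in
theorem ip_left_injective {x y : E} (h : ∀ z : E, (ip x z : B) = ip y z) : x = y := by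
  have h1 : (ip (x + (-1 : ℂ) • y) (x + (-1 : ℂ) • y) : B) = 0 := by
    rw [ip_add_left, ip_smul_left, h]
    simp
  have h2 := norm_sq_eq (B := B) (x + (-1 : ℂ) • y)
  rw [h1, norm_zero] at h2
  have h3 : x + (-1 : ℂ) • y = 0 := by simpa using h2
  simpa [← sub_eq_add_neg, sub_eq_zero] using h3

/-- The algebra `ℒ(E)` of adjointable operators on the Hilbert `B`-module `E`. -/
def adjointable : Subalgebra ℂ (E →L[ℂ] E) where
  carrier := {T | ∃ S : E →L[ℂ] E, ∀ x y, (ip (T x) y : B) = ip x (S y)}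
  mul_mem' := by
    rintro T T' ⟨S, hS⟩ ⟨S', hS'⟩
    exact ⟨S' * S, fun x y => (hS _ _).trans (hS' _ _)⟩
  add_mem' := by
    rintro T T' ⟨S, hS⟩ ⟨S', hS'⟩
    refine ⟨S + S', fun x y => ?_⟩
    simp only [add_apply, ip_add_left, ip_add_right, hS, hS']
  algebraMap_mem' c := by
    refine ⟨star c • 1, fun x y => ?_⟩
    simp only [Algebra.algebraMap_eq_smul_one, smul_apply,
      one_apply_eq_self, ip_smul_left, ip_smul_right]

variable {B E}

theorem adjoint_mem {T S : E →L[ℂ] E} (h : ∀ x y, (ip (T x) y : B) = ip x (S y)) :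
    S ∈ adjointable B E :=
  ⟨T, fun x y => by rw [← star_ip, ← h, star_ip]⟩

/-- The involution of `ℒ(E)`: the adjoint, characterized by `⟨T x, y⟩ = ⟨x, T* y⟩`. -/
instance : Star (adjointable B E) where
  star T := ⟨T.2.choose, adjoint_mem T.2.choose_spec⟩

theorem ip_star (T : adjointable B E) (x y : E) :
    (ip (T.1 x) y : B) = ip x ((star T).1 y) :=
  T.2.choose_spec x y

theorem eq_star {T S : adjointable B E} (h : ∀ x y, (ip (T.1 x) y : B) = ip x (S.1 y)) :
    S = star T := by
  apply Subtype.ext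
  ext y
  apply ip_left_injective (B := B)
  intro x
  rw [← star_ip, ← h, ip_star, star_ip]

instance : StarRing (adjointable B E) where
  star_involutive T := (eq_star fun x y => by rw [← star_ip, ← ip_star, star_ip]).symm
  star_mul T S := (eq_star fun x y => by
    change (ip (T.1 (S.1 x)) y : B) = ip x ((star S).1 ((star T).1 y))
    rw [ip_star, ip_star]).symm
  star_add T S := (eq_star fun x y => by
    change (ip (T.1 x + S.1 x) y : B) = ip x ((star T).1 y + (star S).1 y)
    rw [ip_add_left, ip_add_right, ip_star, ip_star]).symm

variable (B E)

/-- The compact operators `𝒦(E)`: the norm closure of the linear span of the rank-one operators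
`z ↦ x ⟨y, z⟩`. -/
def compacts : Submodule ℂ (E →L[ℂ] E) :=
  (Submodule.span ℂ {T : E →L[ℂ] E | ∃ x y : E, ∀ z : E,
    T z = MulOpposite.op (ip y z : B) • x}).topologicalClosure

/-- The Hilbert module `E` is countably generated: for some countable `S ⊆ E`, the elements `x b`
with `x ∈ S` and `b ∈ B` span a dense subspace. -/
def IsCountablyGenerated : Prop :=
  ∃ S : Set E, S.Countable ∧
    Dense (Submodule.span ℂ {y : E | ∃ x ∈ S, ∃ b : B, y = MulOpposite.op b • x} : Set E)

end general

end RightHilbertModule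

open RightHilbertModule in
/-- Kasparov modules for ungraded C*-algebras `A` and `B` (no grading on `E`, no parity condition on
`V`; these are the cycles that represent the classes of `KK¹(A, B)`): `E` is a countably generated
right Hilbert `B`-module, `ψ : A → ℒ(E)` a *-homomorphism and `V ∈ ℒ(E)`, such that
`ψ(a)(V² - 1)`, `ψ(a)(V - V*)` and `[V, ψ(a)]` are compact for all `a ∈ A`. -/
structure IsKasparovModule {A B E : Type*} [NonUnitalCStarAlgebra A] [NonUnitalCStarAlgebra B]
    [NormedAddCommGroup E] [NormedSpace ℂ E] [CompleteSpace E] [SMul Bᵐᵒᵖ E]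
    [RightHilbertModule B E] (ψ : A →⋆ₙₐ[ℂ] adjointable B E) (V : adjointable B E) : Prop where
  countablyGenerated : IsCountablyGenerated B E
  sq_sub_one (a : A) : (ψ a * (V * V - 1)).1 ∈ compacts B E
  sub_star (a : A) : (ψ a * (V - star V)).1 ∈ compacts B E
  commutator (a : A) : (V * ψ a - ψ a * V).1 ∈ compacts B E

/-- A C*-algebra is `σ`-unital if it has a countable (sequential) approximate unit: an increasing
sequence of positive contractions `e n` with `e n * b → b` and `b * e n → b`. -/
def IsSigmaUnital (B : Type*) [NonUnitalCStarAlgebra B] : Prop :=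
  ∃ e : ℕ → B, (∀ n, ∃ c : B, e n = star c * c) ∧ (∀ n, ‖e n‖ ≤ 1) ∧
    (∀ n, ∃ c : B, e (n + 1) - e n = star c * c) ∧
    ∀ b : B, Filter.Tendsto (fun n => e n * b) Filter.atTop (nhds b) ∧
      Filter.Tendsto (fun n => b * e n) Filter.atTop (nhds b)

/-- The image in `ℒ(H)` of an ideal of a von Neumann algebra on `H`. -/
def idealCarrier {H : Type*} [NormedAddCommGroup H] [InnerProductSpace ℂ H] [CompleteSpace H]
    {N : VonNeumannAlgebra H} (J : Ideal N) : Set (H →L[ℂ] H) :=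
  Subtype.val '' (J : Set N)

/-- A von Neumann spectral triple `(𝒜, H, D)` relative to `(N, J)`: a representation `π` of the
*-algebra `𝒜` in the von Neumann algebra `N` acting on `H`, a norm closed two-sided ideal `J` of
`N`, and a self-adjoint operator `D` affiliated to `N` (that is, commuting with the unitaries of the
commutant of `N`), such that the commutators `[D, π(a)]` are defined on `Dom(D)` and bounded, and
`π(a) (z - D)⁻¹ ∈ J` for all non-real `z`. -/
structure VonNeumannSpectralTriple (𝒜 : Type*) [NonUnitalRing 𝒜] [StarRing 𝒜] [Module ℂ 𝒜]
    [IsScalarTower ℂ 𝒜 𝒜] [SMulCommClass ℂ 𝒜 𝒜] [StarModule ℂ 𝒜]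
    {H : Type*} [NormedAddCommGroup H] [InnerProductSpace ℂ H] [CompleteSpace H]
    (N : VonNeumannAlgebra H) (J : Ideal N) where
  π : 𝒜 →⋆ₙₐ[ℂ] (H →L[ℂ] H)
  π_mem (a : 𝒜) : π a ∈ N
  isTwoSided : J.IsTwoSided
  isClosed : IsClosed (idealCarrier J)
  D : H →ₗ.[ℂ] H
  isSelfAdjoint : IsSelfAdjoint D
  affiliated : ∀ U ∈ unitary (H →L[ℂ] H), U ∈ N.commutant →
    ∀ x : D.domain, ∃ h : U x ∈ D.domain, D ⟨U x, h⟩ = U (D x)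
  bounded_commutator (a : 𝒜) : ∃ h : ∀ x : D.domain, π a x ∈ D.domain,
    ∃ C : H →L[ℂ] H, ∀ x : D.domain, C x = D ⟨π a x, h x⟩ - π a (D x)
  resolvent_mem (a : 𝒜) (z : ℂ) (hz : z.im ≠ 0) :
    π a * UnboundedOperator.resolvent isSelfAdjoint z hz ∈ idealCarrier J

namespace VonNeumannSpectralTriple

section general

variable {𝒜 : Type*} [NonUnitalRing 𝒜] [StarRing 𝒜] [Module ℂ 𝒜]
  [IsScalarTower ℂ 𝒜 𝒜] [SMulCommClass ℂ 𝒜 𝒜] [StarModule ℂ 𝒜]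
  {H : Type*} [NormedAddCommGroup H] [InnerProductSpace ℂ H] [CompleteSpace H]
  {N : VonNeumannAlgebra H} {J : Ideal N} (X : VonNeumannSpectralTriple 𝒜 N J)

/-- The spectral triple is unital: the unit of `N` is in (the image of) `𝒜`. -/
def IsUnital : Prop := ∃ a : 𝒜, X.π a = 1

/-- The C*-algebra `A`, the norm closure of `𝒜` in `ℒ(H)`. -/
def A : NonUnitalStarSubalgebra ℂ (H →L[ℂ] H) :=
  (NonUnitalStarAlgHom.range X.π).topologicalClosure

instance : IsClosed (X.A : Set (H →L[ℂ] H)) :=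
  NonUnitalStarSubalgebra.isClosed_topologicalClosure _

/-- The operator `F_D = D (1 + D²)^(-1/2)`. -/
def F : H →L[ℂ] H := UnboundedOperator.boundedTransform X.isSelfAdjoint

/-- The commutator `[F_D, a]`. -/
def commF (a : 𝒜) : H →L[ℂ] H := X.F * X.π a - X.π a * X.F

/-- The operators `F_D [F_D, a]`, `b [F_D, a]`, `F_D b [F_D, a]` and `a φ(D)`, for `a, b ∈ 𝒜` and
`φ ∈ C₀(ℝ)`. -/
def generators : Set (H →L[ℂ] H) :=
  {T | ∃ a : 𝒜, T = X.F * X.commF a} ∪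
  {T | ∃ a b : 𝒜, T = X.π b * X.commF a} ∪
  {T | ∃ a b : 𝒜, T = X.F * X.π b * X.commF a} ∪
  {T | ∃ (a : 𝒜) (φ : ZeroAtInftyContinuousMap ℝ ℂ),
    T = X.π a * UnboundedOperator.c0Calculus X.isSelfAdjoint φ}

/-- The smallest C*-algebra in `ℒ(H)` that contains the `generators`. -/
def B : NonUnitalStarSubalgebra ℂ (H →L[ℂ] H) :=
  (NonUnitalStarAlgebra.adjoin ℂ X.generators).topologicalClosure

instance : IsClosed (X.B : Set (H →L[ℂ] H)) :=
  NonUnitalStarSubalgebra.isClosed_topologicalClosure _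

end general

end VonNeumannSpectralTriple

end

/-! Write `F` for `F_D`, `P = (1 + D²)⁻¹ = 1 - F²` and `Q = P^(1/2)`. Since the triple is unital,
the generators with `b = 1` or `a = 1` put every `[F, a]` and every `φ(D)` into `B`, in particular
`P`. The other generators are what is needed for `F` and `A` to multiply `B` into itself: right
multiplication by `F` is turned into left multiplication through `[F, a] F = -F [F, a] - [P, a]`,
right multiplication by `c` through the Leibniz rule `[F, a] c = [F, ac] - a [F, c]`. So `F` and `A`
lie in the idealizer of `B`, which acts on the Hilbert module `B` by left multiplication
(`idealizerHom`). The defects `1 - F²` and `[F, a]` lie in `B` itself, and elements of a σ-unital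
algebra act as compact operators on it (`mem_compacts_of_mul`). The statement on unitaries follows
because `p` is, modulo `B`, a projection that commutes with `A`.

Separability of `B` comes from that of `A`, since all `φ(D)` lie in the C*-algebra generated by one
resolvent; a separable C*-algebra is σ-unital.

The analytic point is `B ⊆ J`, that is `[F, a] ∈ J`. The phase `G = F + iQ` of `D + i` is unitary,
and `X = a - G* a G` satisfies `X Q + Q X = Q Y Q` with `Y` bounded (`sylvester_phase`), formally
`Q⁻¹ X + X Q⁻¹ = Y`. Hence `X` is of norm at most `δ ‖Y‖ / 2` when compressed to the region where
`Q` is at most `δ` (`norm_highCutoff_compress_le`), and what remains has a factor in the C*-algebra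
of `Q`, so lies in `J`. Letting `δ → 0` gives `X ∈ J` (`mem_of_mul_add_mul_eq`), and `[F, a] = G X -
i [Q, a]`. As `J` is not assumed to be *-invariant, this is carried out in its *-invariant part
`idealStarCore`. -/

/-! ### Separable C*-algebras are σ-unital, and σ-unital algebras as Hilbert modules over
themselves. -/

-- An increasing sequence is extracted from the canonical approximate unit: the `n`-th step moves up
-- to an element that fixes the first `n + 1` members of a dense sequence up to `1 / (n + 1)`.
open Filter Topology in
theorem isSigmaUnital_of_separable (B : Type*) [NonUnitalCStarAlgebra B]
    [TopologicalSpace.SeparableSpace B] : IsSigmaUnital B := by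
  let _ := CStarAlgebra.spectralOrder B
  have _ := CStarAlgebra.spectralOrderedRing B
  have hl := CStarAlgebra.increasingApproximateUnit B
  let d : ℕ → B := TopologicalSpace.denseSeq B
  have hd : DenseRange d := TopologicalSpace.denseRange_denseSeq B
  have step : ∀ (n : ℕ) (e : {e : B // 0 ≤ e ∧ ‖e‖ < 1}), ∃ f : {e : B // 0 ≤ e ∧ ‖e‖ < 1},
      e.1 ≤ f.1 ∧ ∀ k ≤ n, ‖f.1 * d k - d k‖ < 1 / ((n : ℝ) + 1) := by
    intro n e
    have h1 : ∀ᶠ x in CStarAlgebra.approximateUnit B, e.1 ≤ x := by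
      filter_upwards [(CStarAlgebra.hasBasis_approximateUnit B).mem_of_mem e.2] with x hx
      exact hx.1
    have h2 : ∀ᶠ x in CStarAlgebra.approximateUnit B,
        ∀ k ∈ Set.Iic n, ‖x * d k - d k‖ < 1 / ((n : ℝ) + 1) := by
      rw [eventually_all_finite (Set.finite_Iic n)]
      intro k _
      have := (hl.tendsto_mul_right (d k)).eventually
        (Metric.ball_mem_nhds (d k) (show 0 < 1 / ((n : ℝ) + 1) by positivity))
      filter_upwards [this] with x hx
      simpa [dist_eq_norm] using hx
    obtain ⟨a, ha, hsub⟩ :=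
      (CStarAlgebra.hasBasis_approximateUnit B).eventually_iff.mp (h1.and h2)
    -- The basic sets of the filter are `{x | a ≤ x}` cut with the closed unit ball, so `a` itself
    -- is an admissible choice.
    have := hsub ⟨le_refl a, by simpa using ha.2.le⟩
    exact ⟨⟨a, ha⟩, this.1, fun k hk => this.2 k hk⟩
  choose f hf using step
  let e : ℕ → {e : B // 0 ≤ e ∧ ‖e‖ < 1} := fun n => Nat.rec ⟨0, by simp⟩ (fun n e => f n e) n
  have he : ∀ n, e (n + 1) = f n (e n) := fun n => rfl
  have hsa : ∀ n, star (e n).1 = (e n).1 := fun n => (IsSelfAdjoint.of_nonneg (e n).2.1).star_eq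
  have htend : ∀ b : B, Tendsto (fun n => (e n).1 * b) atTop (𝓝 b) := by
    intro b
    rw [Metric.tendsto_atTop]
    intro ε hε
    obtain ⟨k, hk⟩ := hd.exists_dist_lt b (show 0 < ε / 4 by positivity)
    obtain ⟨m, hm⟩ := exists_nat_one_div_lt (show 0 < ε / 4 by positivity)
    refine ⟨max k m + 1, fun n hn => ?_⟩
    obtain ⟨n, rfl⟩ : ∃ j, n = j + 1 := ⟨n - 1, by omega⟩
    have h1 := (hf n (e n)).2 k (by omega)
    rw [← he] at h1
    have h2 : 1 / ((n : ℝ) + 1) ≤ 1 / ((m : ℝ) + 1) := by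
      have : m ≤ n := by omega
      gcongr
    have h3 : (e (n + 1)).1 * b - b = (e (n + 1)).1 * (b - d k)
        + ((e (n + 1)).1 * d k - d k) - (b - d k) := by
      rw [mul_sub]; abel
    have h4 : ‖(e (n + 1)).1 * (b - d k)‖ ≤ ‖b - d k‖ :=
      (norm_mul_le _ _).trans (mul_le_of_le_one_left (norm_nonneg _) (e (n + 1)).2.2.le)
    rw [dist_eq_norm] at hk
    calc dist ((e (n + 1)).1 * b) b = ‖(e (n + 1)).1 * b - b‖ := dist_eq_norm _ _
      _ ≤ ‖(e (n + 1)).1 * (b - d k)‖ + ‖(e (n + 1)).1 * d k - d k‖ + ‖b - d k‖ := by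
        rw [h3]
        exact (norm_sub_le _ _).trans (by gcongr; exact norm_add_le _ _)
      _ < ε := by linarith
  refine ⟨fun n => (e n).1, fun n => CStarAlgebra.nonneg_iff_eq_star_mul_self.mp (e n).2.1,
    fun n => (e n).2.2.le, fun n => ?_, fun b => ⟨htend b, ?_⟩⟩
  · apply CStarAlgebra.nonneg_iff_eq_star_mul_self.mp
    rw [sub_nonneg]
    exact (hf n (e n)).1
  · have := (continuous_star.tendsto _).comp (htend (star b))
    simpa [Function.comp_def, hsa] using this

open Filter Topology in
theorem RightHilbertModule.isCountablyGenerated_self {B : Type*} [NonUnitalCStarAlgebra B]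
    (h : IsSigmaUnital B) : RightHilbertModule.IsCountablyGenerated B B := by
  obtain ⟨e, -, -, -, he⟩ := h
  refine ⟨Set.range e, Set.countable_range e, fun b => ?_⟩
  refine mem_closure_of_tendsto (he b).1 (Eventually.of_forall fun n => ?_)
  exact Submodule.subset_span ⟨e n, ⟨n, rfl⟩, b, rfl⟩

open Filter Topology in
/-- Left multiplication by an element of a `σ`-unital C*-algebra is a compact operator. -/
theorem RightHilbertModule.mem_compacts_of_mul {B : Type*} [NonUnitalCStarAlgebra B]
    (h : IsSigmaUnital B) {T : B →L[ℂ] B} {t : B} (hT : ∀ x, T x = t * x) :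
    T ∈ RightHilbertModule.compacts B B := by
  obtain ⟨e, -, -, -, he⟩ := h
  have hT' : T = ContinuousLinearMap.mul ℂ B t := by ext x; simp [hT]
  -- Multiplication by `t * e n` is the rank-one operator `z ↦ t ⟨(e n)*, z⟩`, and `t * e n → t` in
  -- norm.
  have h1 : Tendsto (fun n => ContinuousLinearMap.mul ℂ B (t * e n)) atTop (𝓝 T) := by
    rw [hT']
    exact ((ContinuousLinearMap.mul ℂ B).continuous.tendsto t).comp (he t).2
  refine mem_closure_of_tendsto h1 (Eventually.of_forall fun n => Submodule.subset_span ?_)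
  refine ⟨t, star (e n), fun z => ?_⟩
  change t * e n * z = t * (star (star (e n)) * z)
  rw [star_star, mul_assoc]

/-! ### Separability of generated *-algebras. -/

theorem TopologicalSpace.IsSeparable.subsemigroupClosure {M : Type*} [Semigroup M]
    [TopologicalSpace M] [ContinuousMul M] {s : Set M} (hs : TopologicalSpace.IsSeparable s) :
    TopologicalSpace.IsSeparable (Subsemigroup.closure s : Set M) := by
  -- `p n` consists of the products of `n + 1` elements of `s`.
  let p : ℕ → Set M := fun n => Nat.rec s (fun _ t => Set.image2 (· * ·) s t) n
  have hp : ∀ n, p (n + 1) = Set.image2 (· * ·) s (p n) := fun n => rfl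
  have h1 : ∀ n, TopologicalSpace.IsSeparable (p n) := by
    intro n
    induction n with
    | zero => exact hs
    | succ n ih =>
      rw [hp, ← Set.image_prod]
      exact (hs.prod ih).image continuous_mul
  have h2 : TopologicalSpace.IsSeparable (⋃ n, p n) := .iUnion h1
  have hmul : ∀ m x, x ∈ p m → ∀ y ∈ ⋃ n, p n, x * y ∈ ⋃ n, p n := by
    intro m
    induction m with
    | zero =>
      intro x hx y hy
      obtain ⟨n, hn⟩ := Set.mem_iUnion.mp hy
      exact Set.mem_iUnion.mpr ⟨n + 1, Set.mem_image2_of_mem hx hn⟩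
    | succ m ih =>
      rintro _ ⟨a, ha, b, hb, rfl⟩ y hy
      obtain ⟨n, hn⟩ := Set.mem_iUnion.mp (ih b hb y hy)
      refine Set.mem_iUnion.mpr ⟨n + 1, ?_⟩
      rw [hp]
      exact ⟨a, ha, _, hn, (mul_assoc _ _ _).symm⟩
  refine h2.mono fun x hx => ?_
  induction hx using Subsemigroup.closure_induction with
  | mem x hx => exact Set.mem_iUnion.mpr ⟨0, hx⟩
  | mul x y _ _ hx hy =>
    obtain ⟨m, hm⟩ := Set.mem_iUnion.mp hx
    exact hmul m x hm y hy

theorem TopologicalSpace.IsSeparable.nonUnitalStarAlgebra_adjoin {M : Type*} [NonUnitalCStarAlgebra M]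
    {s : Set M} (hs : TopologicalSpace.IsSeparable s) :
    TopologicalSpace.IsSeparable (NonUnitalStarAlgebra.adjoin ℂ s : Set M) := by
  have h1 : TopologicalSpace.IsSeparable (s ∪ star s) := by
    refine hs.union ?_
    rw [← Set.image_star]
    exact hs.image continuous_star
  have h2 := h1.subsemigroupClosure.span (R := ℂ)
  rw [← NonUnitalAlgebra.adjoin_eq_span] at h2
  exact h2
-- The idealizer of a closed *-subalgebra and its action by left multiplication.
namespace NonUnitalStarSubalgebra

variable {A : Type*} [CStarAlgebra A] (S : NonUnitalStarSubalgebra ℂ A)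

/-- The idealizer of `S` in `A`: the elements `t` with `t S ⊆ S` and `S t ⊆ S`. -/
noncomputable def idealizer : StarSubalgebra ℂ A where
  carrier := {t | ∀ x ∈ S, t * x ∈ S ∧ x * t ∈ S}
  mul_mem' {s t} hs ht x hx := by
    refine ⟨?_, ?_⟩
    · rw [mul_assoc]; exact (hs _ (ht x hx).1).1
    · rw [← mul_assoc]; exact (ht _ (hs x hx).2).2
  add_mem' {s t} hs ht x hx := by
    rw [add_mul, mul_add]
    exact ⟨add_mem (hs x hx).1 (ht x hx).1, add_mem (hs x hx).2 (ht x hx).2⟩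
  algebraMap_mem' c x hx := by
    rw [Algebra.algebraMap_eq_smul_one, smul_mul_assoc, one_mul, mul_smul_comm, mul_one]
    exact ⟨S.smul_mem' c hx, S.smul_mem' c hx⟩
  star_mem' {t} ht x hx := by
    have h1 := star_mem (ht (star x) (star_mem hx)).1
    have h2 := star_mem (ht (star x) (star_mem hx)).2
    rw [star_mul, star_star] at h1 h2
    exact ⟨h2, h1⟩

theorem mem_idealizer {t : A} : t ∈ S.idealizer ↔ ∀ x ∈ S, t * x ∈ S ∧ x * t ∈ S := Iff.rfl

theorem le_idealizer {t : A} (ht : t ∈ S) : t ∈ S.idealizer :=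
  fun _ hx => ⟨mul_mem ht hx, mul_mem hx ht⟩

theorem isClosed_idealizer (hS : IsClosed (S : Set A)) : IsClosed (S.idealizer : Set A) := by
  have : (S.idealizer : Set A) = ⋂ x ∈ S, {t | t * x ∈ S} ∩ {t | x * t ∈ S} := by
    ext t; simp [mem_idealizer]
  rw [this]
  refine isClosed_biInter fun x _ => IsClosed.inter ?_ ?_
  · exact hS.preimage (continuous_id.mul continuous_const)
  · exact hS.preimage (continuous_const.mul continuous_id)

variable [hS : IsClosed (S : Set A)]

/-- Left multiplication by an element of the idealizer of `S`, as an operator on `S`. -/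
noncomputable def idealizerMul (t : S.idealizer) : S →L[ℂ] S :=
  LinearMap.mkContinuous
    { toFun x := ⟨t * x, (t.2 x x.2).1⟩
      map_add' _ _ := Subtype.ext (mul_add _ _ _)
      map_smul' _ _ := Subtype.ext (mul_smul_comm _ _ _) } ‖(t : A)‖ fun x => norm_mul_le (t : A) (x : A)

theorem coe_idealizerMul (t : S.idealizer) (x : S) : (S.idealizerMul t x : A) = t * x := rfl

theorem ip_idealizerMul (t : S.idealizer) (x y : S) :
    (RightHilbertModule.ip (S.idealizerMul t x) y : S)
      = RightHilbertModule.ip x (S.idealizerMul (star t) y) := by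
  apply Subtype.ext
  change star ((t : A) * x) * (y : A) = star (x : A) * (star (t : A) * y)
  rw [star_mul, mul_assoc]

/-- The representation of the idealizer of `S` on the Hilbert module `S` by left multiplication. -/
noncomputable def idealizerHom : S.idealizer →⋆ₐ[ℂ] RightHilbertModule.adjointable S S where
  toFun t := ⟨S.idealizerMul t, S.idealizerMul (star t), S.ip_idealizerMul t⟩
  map_one' := by ext x; simp [coe_idealizerMul]
  map_mul' s t := by ext x; simp [coe_idealizerMul, mul_assoc]
  map_zero' := by ext x; simp [coe_idealizerMul]
  map_add' s t := by ext x; simp [coe_idealizerMul, add_mul]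
  commutes' c := by
    ext x
    simp [coe_idealizerMul, Algebra.algebraMap_eq_smul_one]
  map_star' t := RightHilbertModule.eq_star fun x y => S.ip_idealizerMul t x y

theorem idealizerHom_mem_compacts (h : IsSigmaUnital S) {t : S.idealizer} (ht : (t : A) ∈ S) :
    (S.idealizerHom t).1 ∈ RightHilbertModule.compacts S S :=
  RightHilbertModule.mem_compacts_of_mul h (t := ⟨t, ht⟩) fun _ => Subtype.ext rfl

end NonUnitalStarSubalgebra
-- A norm estimate for the operator equation `X Q + Q X = Q Y Q`.
-- The hypothesis `ha` says in terms of norms that `a ≥ c`. Expanding `(1 - s a) w (1 - s a)` gives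
-- `‖w‖ ≤ (1 - s c)² ‖w‖ + s ‖y‖ + O(s²)`; divide by `s` and let `s → 0`.
open Filter Topology in
theorem norm_le_of_mul_add_mul_eq {A : Type*} [NormedRing A] [NormedAlgebra ℝ A] {a w y : A}
    {c s₀ : ℝ} (hs₀ : 0 < s₀)
    (ha : ∀ s : ℝ, 0 < s → s < s₀ → ‖1 - s • a‖ ≤ 1 - s * c) (h : a * w + w * a = y) :
    2 * c * ‖w‖ ≤ ‖y‖ := by
  have key : ∀ s : ℝ, 0 < s → s < s₀ →
      2 * c * ‖w‖ ≤ ‖y‖ + s * ((c ^ 2 + ‖a‖ ^ 2) * ‖w‖) := by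
    intro s hs hs'
    have h1 : w = (1 - s • a) * w * (1 - s • a) + s • y - (s ^ 2) • (a * w * a) := by
      rw [← h]
      simp only [sub_mul, mul_sub, one_mul, mul_one, smul_mul_assoc, mul_smul_comm, smul_add, sq]
      module
    have h2 := ha s hs hs'
    have h3 : ‖(1 - s • a) * w * (1 - s • a)‖ ≤ (1 - s * c) * ‖w‖ * (1 - s * c) :=
      (norm_mul_le _ _).trans (mul_le_mul ((norm_mul_le _ _).trans (by gcongr)) h2
        (norm_nonneg _) (mul_nonneg ((norm_nonneg _).trans h2) (norm_nonneg _)))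
    have h4 : ‖(s ^ 2) • (a * w * a)‖ ≤ s ^ 2 * (‖a‖ * ‖w‖ * ‖a‖) := by
      rw [norm_smul, Real.norm_of_nonneg (by positivity)]
      gcongr
      exact (norm_mul_le _ _).trans (by gcongr; exact norm_mul_le _ _)
    have h5 : ‖s • y‖ = s * ‖y‖ := by rw [norm_smul, Real.norm_of_nonneg hs.le]
    have h6 : ‖w‖ ≤ (1 - s * c) * ‖w‖ * (1 - s * c) + s * ‖y‖ + s ^ 2 * (‖a‖ * ‖w‖ * ‖a‖) := by
      conv_lhs => rw [h1]
      refine (norm_sub_le _ _).trans (add_le_add ((norm_add_le _ _).trans ?_) h4)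
      rw [h5]
      gcongr
    have h7 : s * (2 * c * ‖w‖) ≤ s * (‖y‖ + s * ((c ^ 2 + ‖a‖ ^ 2) * ‖w‖)) := by
      linarith
    exact le_of_mul_le_mul_left h7 hs
  have hlim : Tendsto (fun s : ℝ => ‖y‖ + s * ((c ^ 2 + ‖a‖ ^ 2) * ‖w‖)) (𝓝[>] 0) (𝓝 ‖y‖) := by
    have : Continuous fun s : ℝ => ‖y‖ + s * ((c ^ 2 + ‖a‖ ^ 2) * ‖w‖) := by fun_prop
    simpa using (this.tendsto 0).mono_left nhdsWithin_le_nhds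
  refine ge_of_tendsto hlim ?_
  filter_upwards [Ioo_mem_nhdsGT hs₀] with s hs
  exact key s hs.1 hs.2

section Cutoff

variable {H : Type*} [NormedAddCommGroup H] [InnerProductSpace ℂ H] [CompleteSpace H]

-- The compressions `e n * Z * e n` converge strongly to `Z`, and a bound on the norm survives
-- strong limits.
omit [CompleteSpace H] in
open Filter Topology in
theorem ContinuousLinearMap.norm_le_of_tendsto_compress {e : ℕ → H →L[ℂ] H} {Z : H →L[ℂ] H} {K : ℝ}
    (he : ∀ n, ‖e n‖ ≤ 1) (hlim : ∀ u, Tendsto (fun n => e n u) atTop (𝓝 u))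
    (hK : ∀ᶠ n in atTop, ‖e n * Z * e n‖ ≤ K) : ‖Z‖ ≤ K := by
  have hK0 : 0 ≤ K := by
    obtain ⟨n, hn⟩ := hK.exists
    exact (norm_nonneg _).trans hn
  refine ContinuousLinearMap.opNorm_le_bound _ hK0 fun u => ?_
  have h1 : Tendsto (fun n => e n (Z (e n u - u)) + e n (Z u)) atTop (𝓝 (0 + Z u)) := by
    refine Tendsto.add ?_ (hlim _)
    have h2 : Tendsto (fun n => ‖Z (e n u - u)‖) atTop (𝓝 0) := by
      have h3 : Tendsto (fun n => e n u - u) atTop (𝓝 0) := by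
        simpa using (hlim u).sub_const u
      simpa using ((Z.continuous.tendsto 0).comp h3).norm
    refine squeeze_zero_norm (fun n => ?_) h2
    exact ((e n).le_opNorm _).trans (mul_le_of_le_one_left (norm_nonneg _) (he n))
  rw [zero_add] at h1
  refine le_of_tendsto h1.norm ?_
  filter_upwards [hK] with n hn
  have h4 : e n (Z (e n u - u)) + e n (Z u) = (e n * Z * e n) u := by
    simp [map_sub]
  rw [h4]
  exact ((e n * Z * e n).le_opNorm u).trans (by gcongr)

variable {Q : H →L[ℂ] H}

/-- The function `x ↦ 1 - η / max x η`, which vanishes for `x ≤ η`. -/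
noncomputable def lowCutoff (η x : ℝ) : ℝ := 1 - η * (max x η)⁻¹

/-- The function `x ↦ max 0 (1 - x / δ)`, which vanishes for `x ≥ δ`. -/
noncomputable def highCutoff (δ x : ℝ) : ℝ := max 0 (1 - x / δ)

theorem continuous_inv_max {η : ℝ} (hη : 0 < η) : Continuous fun x : ℝ => (max x η)⁻¹ :=
  (continuous_id.max continuous_const).inv₀ fun _ => (lt_max_of_lt_right hη).ne'

theorem continuous_lowCutoff {η : ℝ} (hη : 0 < η) : Continuous (lowCutoff η) :=
  continuous_const.sub (continuous_const.mul (continuous_inv_max hη))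

theorem continuous_highCutoff (δ : ℝ) : Continuous (highCutoff δ) := by
  unfold highCutoff; fun_prop

theorem lowCutoff_mem_Icc {η : ℝ} (hη : 0 < η) (x : ℝ) : lowCutoff η x ∈ Set.Icc (0 : ℝ) 1 := by
  have h1 : 0 < max x η := lt_max_of_lt_right hη
  have h2 : η * (max x η)⁻¹ ≤ 1 := by
    rw [← div_eq_mul_inv, div_le_one h1]; exact le_max_right _ _
  have h3 : 0 ≤ η * (max x η)⁻¹ := by positivity
  exact ⟨by unfold lowCutoff; linarith, by unfold lowCutoff; linarith⟩

theorem highCutoff_mem_Icc {δ : ℝ} (hδ : 0 < δ) {x : ℝ} (hx : 0 ≤ x) :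
    highCutoff δ x ∈ Set.Icc (0 : ℝ) 1 :=
  ⟨le_max_left _ _, max_le zero_le_one (by have : 0 ≤ x / δ := by positivity
                                           linarith)⟩

-- The operators are contractions, and `|η x / max x η| ≤ η` for `x ≥ 0` shows that multiplied by
-- `Q` they converge to `Q` in norm; hence they converge on the dense range of `Q`, and then
-- everywhere.
open Filter Topology in
theorem tendsto_cfc_lowCutoff (hQ : 0 ≤ Q) (hd : DenseRange Q) (u : H) :
    Tendsto (fun n : ℕ => cfc (lowCutoff (1 / ((n : ℝ) + 1))) Q u) atTop (𝓝 u) := by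
  have hη : ∀ n : ℕ, (0 : ℝ) < 1 / ((n : ℝ) + 1) := fun n => by positivity
  have hQs : IsSelfAdjoint Q := .of_nonneg hQ
  have hn : ∀ n : ℕ, ‖cfc (lowCutoff (1 / ((n : ℝ) + 1))) Q‖ ≤ 1 := fun n =>
    norm_cfc_le zero_le_one fun x _ => by
      have := lowCutoff_mem_Icc (hη n) x
      rw [Real.norm_of_nonneg this.1]; exact this.2
  have hQn : ∀ n : ℕ, ‖cfc (lowCutoff (1 / ((n : ℝ) + 1))) Q * Q - Q‖ ≤ 1 / ((n : ℝ) + 1) := by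
    intro n
    have hc := (continuous_lowCutoff (hη n)).continuousOn (s := spectrum ℝ Q)
    have h1 : cfc (lowCutoff (1 / ((n : ℝ) + 1))) Q * Q - Q
        = cfc (fun x : ℝ => lowCutoff (1 / ((n : ℝ) + 1)) x * x - x) Q := by
      rw [cfc_sub (fun x : ℝ => lowCutoff (1 / ((n : ℝ) + 1)) x * x) (fun x => x) Q
        (hc.mul continuousOn_id) continuousOn_id, cfc_mul _ (fun x : ℝ => x) Q hc continuousOn_id,
        cfc_id' ℝ Q]
    rw [h1]
    refine norm_cfc_le (hη n).le fun x hx => ?_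
    have hx0 : 0 ≤ x := spectrum_nonneg_of_nonneg hQ hx
    have h2 : 0 < max x (1 / ((n : ℝ) + 1)) := lt_max_of_lt_right (hη n)
    have h3 : lowCutoff (1 / ((n : ℝ) + 1)) x * x - x
        = -(1 / ((n : ℝ) + 1) * (x / max x (1 / ((n : ℝ) + 1)))) := by
      unfold lowCutoff; ring
    rw [h3, norm_neg, Real.norm_of_nonneg (by positivity)]
    exact mul_le_of_le_one_right (hη n).le ((div_le_one h2).mpr (le_max_left _ _))
  rw [Metric.tendsto_atTop]
  intro ε hε
  obtain ⟨v, hv⟩ := hd.exists_dist_lt u (show 0 < ε / 3 by positivity)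
  obtain ⟨m, hm⟩ := exists_nat_one_div_lt (show 0 < ε / 3 / (‖v‖ + 1) by positivity)
  refine ⟨m, fun n hmn => ?_⟩
  set e := cfc (lowCutoff (1 / ((n : ℝ) + 1))) Q
  have h1 : e u - u = e (u - Q v) + (e * Q - Q) v - (u - Q v) := by
    simp [map_sub]
  have h2 : ‖e (u - Q v)‖ ≤ ‖u - Q v‖ :=
    (e.le_opNorm _).trans (mul_le_of_le_one_left (norm_nonneg _) (hn n))
  have h3 : ‖(e * Q - Q) v‖ < ε / 3 := by
    calc ‖(e * Q - Q) v‖ ≤ 1 / ((n : ℝ) + 1) * ‖v‖ :=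
          ((e * Q - Q).le_opNorm v).trans (by gcongr; exact hQn n)
      _ ≤ 1 / ((m : ℝ) + 1) * (‖v‖ + 1) := by
          have : (1 : ℝ) / ((n : ℝ) + 1) ≤ 1 / ((m : ℝ) + 1) := by gcongr
          gcongr
          linarith
      _ < ε / 3 := by rwa [← lt_div_iff₀ (by positivity)]
  rw [dist_eq_norm] at hv
  rw [dist_eq_norm, h1]
  calc _ ≤ ‖e (u - Q v)‖ + ‖(e * Q - Q) v‖ + ‖u - Q v‖ :=
        (norm_sub_le _ _).trans (by gcongr; exact norm_add_le _ _)
    _ < ε := by linarith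

/-- If `X Q + Q X = Q Y Q`, that is `Q⁻¹ X + X Q⁻¹ = Y`, then the compression of `X` to the part of
the spectrum where `Q⁻¹ ≥ δ⁻¹` is bounded by `δ ‖Y‖ / 2`. -/
theorem norm_highCutoff_compress_le (hQ : 0 ≤ Q) (hd : DenseRange Q) {X Y : H →L[ℂ] H}
    (h : X * Q + Q * X = Q * Y * Q) {δ : ℝ} (hδ : 0 < δ) :
    ‖cfc (highCutoff δ) Q * X * cfc (highCutoff δ) Q‖ ≤ δ / 2 * ‖Y‖ := by
  have hQs : IsSelfAdjoint Q := .of_nonneg hQ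
  set k := cfc (highCutoff δ) Q with hk
  have hη : ∀ n : ℕ, (0 : ℝ) < 1 / ((n : ℝ) + 1) := fun n => by positivity
  refine ContinuousLinearMap.norm_le_of_tendsto_compress
    (e := fun n : ℕ => cfc (lowCutoff (1 / ((n : ℝ) + 1))) Q) (fun n => ?_)
    (tendsto_cfc_lowCutoff hQ hd) ?_
  · refine norm_cfc_le zero_le_one fun x _ => ?_
    have := lowCutoff_mem_Icc (hη n) x
    rw [Real.norm_of_nonneg this.1]; exact this.2
  obtain ⟨m, hm⟩ := exists_nat_one_div_lt hδ
  filter_upwards [Filter.eventually_ge_atTop m] with n hn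
  have hnδ : 1 / ((n : ℝ) + 1) < δ := by
    have : (1 : ℝ) / ((n : ℝ) + 1) ≤ 1 / ((m : ℝ) + 1) := by gcongr
    linarith
  have hη := hη n
  set η := 1 / ((n : ℝ) + 1)
  set e := cfc (lowCutoff η) Q with he
  have hpos : ∀ x : ℝ, 0 < min (max x η) δ := fun x => lt_min (lt_max_of_lt_right hη) hδ
  have hcA : Continuous fun x : ℝ => (min (max x η) δ)⁻¹ :=
    ((continuous_id.max continuous_const).min continuous_const).inv₀ fun x => (hpos x).ne'
  -- A bounded substitute for `Q⁻¹`, with spectrum in `[δ⁻¹, η⁻¹]`.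
  set a := cfc (fun x : ℝ => (min (max x η) δ)⁻¹) Q with ha
  have hcl := continuous_lowCutoff hη
  have hch := continuous_highCutoff δ
  set t := cfc (fun x => highCutoff δ x * lowCutoff η x) Q with ht
  have ht1 : k * e = t := by rw [ht, cfc_mul _ _ Q hch.continuousOn hcl.continuousOn]
  have ht2 : e * k = t := by rw [← ht1]; exact cfc_commute_cfc _ _ _
  -- The function defining `t` is supported in `[η, δ]`, and there `a` inverts `Q`.
  have hat : a * t * Q = t := by
    have hc1 : Continuous fun x => highCutoff δ x * lowCutoff η x := hch.mul hcl
    have hc2 : Continuous fun x => (min (max x η) δ)⁻¹ * (highCutoff δ x * lowCutoff η x) :=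
      hcA.mul hc1
    rw [ht, ha, ← cfc_mul _ _ Q hcA.continuousOn hc1.continuousOn]
    nth_rw 2 [← cfc_id' ℝ Q]
    rw [← cfc_mul _ _ Q hc2.continuousOn (continuousOn_id' _)]
    refine cfc_congr fun x hx => ?_
    have hx0 : 0 ≤ x := spectrum_nonneg_of_nonneg hQ hx
    rcases le_total x η with h1 | h1
    · have : lowCutoff η x = 0 := by
        rw [lowCutoff, max_eq_right h1, mul_inv_cancel₀ hη.ne', sub_self]
      simp [this]
    rcases le_total δ x with h2 | h2
    · have : highCutoff δ x = 0 := max_eq_left (by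
        have : 1 ≤ x / δ := (one_le_div hδ).mpr h2
        linarith)
      simp [this]
    · have hx1 : x ≠ 0 := (hη.trans_le h1).ne'
      simp only [max_eq_left h1, min_eq_left h2]
      field_simp
  have hcat : Commute a t := cfc_commute_cfc _ _ _
  have hcaQ : Commute a Q := by
    have := cfc_commute_cfc (fun x : ℝ => (min (max x η) δ)⁻¹) id Q
    rwa [cfc_id ℝ Q] at this
  have hctQ : Commute t Q := by
    have := cfc_commute_cfc (fun x : ℝ => highCutoff δ x * lowCutoff η x) id Q
    rwa [cfc_id ℝ Q] at this
  have hat' : Q * t * a = t := by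
    rw [← hctQ.eq, mul_assoc, ← hcaQ.eq, ← mul_assoc, ← hcat.eq, hat]
  -- This is `h` multiplied by `a * t` from the left and by `t * a` from the right.
  have heq : a * (t * X * t) + (t * X * t) * a = t * Y * t := by
    calc a * (t * X * t) + (t * X * t) * a
        = a * t * X * (Q * t * a) + (a * t * Q) * X * t * a := by rw [hat, hat']; noncomm_ring
      _ = a * t * (X * Q + Q * X) * t * a := by noncomm_ring
      _ = (a * t * Q) * Y * (Q * t * a) := by rw [h]; noncomm_ring
      _ = t * Y * t := by rw [hat, hat']
  -- For `0 < s < η` the operator `1 - s a` has spectrum in `[0, 1 - s / δ]`.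
  have hsyl := norm_le_of_mul_add_mul_eq (c := δ⁻¹) hη (fun s hs hs' => ?_) heq
  · have hnt : ‖t‖ ≤ 1 := norm_cfc_le zero_le_one fun x hx => by
      have h1 := lowCutoff_mem_Icc hη x
      have h2 := highCutoff_mem_Icc hδ (spectrum_nonneg_of_nonneg hQ hx)
      rw [Real.norm_of_nonneg (mul_nonneg h2.1 h1.1)]
      exact mul_le_one₀ h2.2 h1.1 h1.2
    have hY : ‖t * Y * t‖ ≤ ‖Y‖ := by
      calc ‖t * Y * t‖ ≤ ‖t‖ * ‖Y‖ * ‖t‖ := (norm_mul_le _ _).trans (by gcongr; exact norm_mul_le _ _)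
        _ ≤ 1 * ‖Y‖ * 1 := by gcongr
        _ = ‖Y‖ := by ring
    have hW : e * (k * X * k) * e = t * X * t := by
      calc e * (k * X * k) * e = (e * k) * X * (k * e) := by noncomm_ring
        _ = _ := by rw [ht1, ht2]
    rw [hW]
    have h1 := hsyl.trans hY
    have h2 : δ / 2 * (2 * δ⁻¹ * ‖t * X * t‖) = ‖t * X * t‖ := by field_simp
    rw [← h2]
    gcongr
  · have h1 : (1 : H →L[ℂ] H) - s • a = cfc (fun x : ℝ => 1 - s • (min (max x η) δ)⁻¹) Q := by
      have hc : Continuous fun x : ℝ => s • (min (max x η) δ)⁻¹ := hcA.const_smul s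
      rw [cfc_sub _ _ Q continuousOn_const hc.continuousOn, cfc_const_one ℝ Q,
        cfc_smul _ _ Q hcA.continuousOn]
    rw [h1]
    have hb : ∀ x : ℝ, δ⁻¹ ≤ (min (max x η) δ)⁻¹ ∧ (min (max x η) δ)⁻¹ ≤ η⁻¹ := fun x =>
      ⟨inv_anti₀ (hpos x) (min_le_right _ _),
        inv_anti₀ hη (le_min (le_max_right _ _) hnδ.le)⟩
    have hb0 := hb 0
    have hb' : ∀ x : ℝ, s * δ⁻¹ ≤ s * (min (max x η) δ)⁻¹ ∧ s * (min (max x η) δ)⁻¹ ≤ 1 := by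
      intro x
      refine ⟨by have := (hb x).1; gcongr, ?_⟩
      calc s * (min (max x η) δ)⁻¹ ≤ η * η⁻¹ := by
            have := (hb x).2
            have := (hpos x)
            gcongr
        _ = 1 := mul_inv_cancel₀ hη.ne'
    refine norm_cfc_le ?_ fun x _ => ?_
    · have := hb' 0; linarith
    · have := hb' x
      rw [smul_eq_mul, Real.norm_of_nonneg (by linarith)]
      linarith

end Cutoff
-- Algebraic relations between the resolvents, `Q = (1 + T²)^(-1/2)` and the bounded transform `F`.
namespace UnboundedOperator

variable {H : Type*} [NormedAddCommGroup H] [InnerProductSpace ℂ H] [CompleteSpace H]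
  {T : H →ₗ.[ℂ] H} (hT : IsSelfAdjoint T)

theorem apply_resolvent {z : ℂ} (hz : z.im ≠ 0) (x : H) :
    T ⟨resolvent hT z hz x, resolvent_mem hT hz x⟩ = z • resolvent hT z hz x - x := by
  have h := sub_resolvent hT hz x
  rw [eq_sub_iff_add_eq, ← eq_sub_iff_add_eq', h]

theorem resolvent_sub_resolvent {z w : ℂ} (hz : z.im ≠ 0) (hw : w.im ≠ 0) :
    resolvent hT z hz - resolvent hT w hw = (w - z) • (resolvent hT w hw * resolvent hT z hz) := by
  ext x
  have h : resolvent hT w hw (w • resolvent hT z hz x - T ⟨_, resolvent_mem hT hz x⟩)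
    = resolvent hT z hz x := resolvent_sub hT hw ⟨_, resolvent_mem hT hz x⟩
  rw [apply_resolvent, ← sub_add, ← sub_smul, map_add, map_smul] at h
  change resolvent hT z hz x - resolvent hT w hw x
    = (w - z) • resolvent hT w hw (resolvent hT z hz x)
  rw [sub_eq_iff_eq_add, h]

theorem resolvent_neg_eq : resolvent hT (-Complex.I) neg_I_im_ne
    = resolvent hT Complex.I I_im_ne + (2 * Complex.I) • invOneAddSq hT := by
  have h := resolvent_sub_resolvent hT neg_I_im_ne I_im_ne
  rw [sub_eq_iff_eq_add'] at h
  rw [h, invOneAddSq]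
  congr 2
  ring

/-- The resolvent identity for `(i, -i)` and for `(-i, i)` expresses both products through the same
difference of resolvents. -/
theorem resolvent_comm :
    resolvent hT Complex.I I_im_ne * resolvent hT (-Complex.I) neg_I_im_ne
      = resolvent hT (-Complex.I) neg_I_im_ne * resolvent hT Complex.I I_im_ne := by
  have h1 := resolvent_sub_resolvent hT I_im_ne neg_I_im_ne
  have h2 := resolvent_neg_eq hT
  rw [invOneAddSq] at h2
  have h3 : (2 * Complex.I) • (resolvent hT Complex.I I_im_ne *
      resolvent hT (-Complex.I) neg_I_im_ne) = (2 * Complex.I) •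
      (resolvent hT (-Complex.I) neg_I_im_ne * resolvent hT Complex.I I_im_ne) := by
    rw [← sub_eq_iff_eq_add'] at h2
    rw [← h2, ← neg_sub, h1]
    module
  exact smul_right_injective _ (by simp) h3

theorem isStarNormal_resolvent : IsStarNormal (resolvent hT Complex.I I_im_ne) := by
  refine ⟨?_⟩
  rw [adjoint_resolvent]
  exact (resolvent_comm hT).symm

theorem invSqrtOneAddSq_nonneg : 0 ≤ invSqrtOneAddSq hT := CFC.sqrt_nonneg _

theorem star_invSqrtOneAddSq : star (invSqrtOneAddSq hT) = invSqrtOneAddSq hT :=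
  (IsSelfAdjoint.of_nonneg (invSqrtOneAddSq_nonneg hT)).star_eq

theorem invSqrtOneAddSq_mul_self :
    invSqrtOneAddSq hT * invSqrtOneAddSq hT = invOneAddSq hT :=
  CFC.sqrt_mul_sqrt_self (invOneAddSq hT) (invOneAddSq_nonneg hT)

theorem invOneAddSq_injective {x : H} (h : invOneAddSq hT x = 0) : x = 0 :=
  resolvent_eq_zero hT _ _ (resolvent_eq_zero hT _ _ h)

theorem invSqrtOneAddSq_injective {x : H} (h : invSqrtOneAddSq hT x = 0) : x = 0 := by
  apply invOneAddSq_injective hT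
  rw [← invSqrtOneAddSq_mul_self]
  change invSqrtOneAddSq hT (invSqrtOneAddSq hT x) = 0
  rw [h, map_zero]

theorem invSqrtOneAddSq_mul_left_cancel {A B : H →L[ℂ] H}
    (h : invSqrtOneAddSq hT * A = invSqrtOneAddSq hT * B) : A = B := by
  ext x
  rw [← sub_eq_zero]
  apply invSqrtOneAddSq_injective hT
  rw [map_sub, sub_eq_zero]
  exact DFunLike.congr_fun h x

theorem denseRange_invSqrtOneAddSq : DenseRange (invSqrtOneAddSq hT) := by
  set Q := invSqrtOneAddSq hT with hQ
  have hker : Q.rangeᗮ = ⊥ := by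
    rw [Submodule.eq_bot_iff]
    intro w hw
    apply invSqrtOneAddSq_injective hT
    rw [← hQ, ← inner_self_eq_zero (𝕜 := ℂ)]
    have hs : ContinuousLinearMap.adjoint Q = Q := star_invSqrtOneAddSq hT
    have h1 := ContinuousLinearMap.adjoint_inner_left Q (Q w) w
    rw [hs] at h1
    rw [h1]
    exact Submodule.inner_left_of_mem_orthogonal
      (LinearMap.mem_range_self (Q : H →ₗ[ℂ] H) (Q w)) hw
  have := (Submodule.topologicalClosure_eq_top_iff (K := Q.range)).mpr hker
  exact Submodule.dense_iff_topologicalClosure_eq_top.mpr this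

theorem commute_invOneAddSq_of_commute {S : H →L[ℂ] H}
    (h1 : Commute S (resolvent hT Complex.I I_im_ne))
    (h2 : Commute S (resolvent hT (-Complex.I) neg_I_im_ne)) : Commute S (invOneAddSq hT) :=
  h1.mul_right h2

theorem commute_invSqrtOneAddSq_of_commute {S : H →L[ℂ] H}
    (h1 : Commute S (resolvent hT Complex.I I_im_ne))
    (h2 : Commute S (resolvent hT (-Complex.I) neg_I_im_ne)) : Commute S (invSqrtOneAddSq hT) := by
  have := (commute_invOneAddSq_of_commute hT h1 h2).symm.cfc_nnreal NNReal.sqrt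
  rw [invSqrtOneAddSq, CFC.sqrt_eq_cfc]
  exact this.symm

theorem commute_resolvent_invSqrtOneAddSq :
    Commute (resolvent hT Complex.I I_im_ne) (invSqrtOneAddSq hT) :=
  commute_invSqrtOneAddSq_of_commute hT (Commute.refl _) (resolvent_comm hT)

theorem commute_resolvent_neg_invSqrtOneAddSq :
    Commute (resolvent hT (-Complex.I) neg_I_im_ne) (invSqrtOneAddSq hT) :=
  commute_invSqrtOneAddSq_of_commute hT (resolvent_comm hT).symm (Commute.refl _)

theorem boundedTransform_mul_resolvent {z : ℂ} (hz : z.im ≠ 0)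
    (hc : Commute (resolvent hT z hz) (invSqrtOneAddSq hT)) :
    boundedTransform hT * resolvent hT z hz
      = z • (resolvent hT z hz * invSqrtOneAddSq hT) - invSqrtOneAddSq hT := by
  ext x
  have h1 : invSqrtOneAddSq hT (resolvent hT z hz x) = resolvent hT z hz (invSqrtOneAddSq hT x) :=
    DFunLike.congr_fun hc.eq.symm x
  change boundedTransform hT (resolvent hT z hz x) = _
  rw [boundedTransform_apply]
  simp_rw [h1]
  rw [apply_resolvent]
  rfl

theorem resolvent_mul_boundedTransform {z : ℂ} (hz : z.im ≠ 0) :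
    resolvent hT z hz * boundedTransform hT
      = z • (resolvent hT z hz * invSqrtOneAddSq hT) - invSqrtOneAddSq hT := by
  ext x
  have h : resolvent hT z hz (z • invSqrtOneAddSq hT x - T ⟨_, invSqrtOneAddSq_mem hT x⟩)
    = invSqrtOneAddSq hT x := resolvent_sub hT hz ⟨_, invSqrtOneAddSq_mem hT x⟩
  rw [← boundedTransform_apply, map_sub, map_smul, sub_eq_iff_eq_add] at h
  change resolvent hT z hz (boundedTransform hT x)
    = z • resolvent hT z hz (invSqrtOneAddSq hT x) - invSqrtOneAddSq hT x
  rw [h, add_sub_cancel_left]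

theorem commute_boundedTransform_resolvent :
    Commute (boundedTransform hT) (resolvent hT Complex.I I_im_ne) := by
  rw [commute_iff_eq, resolvent_mul_boundedTransform,
    boundedTransform_mul_resolvent hT I_im_ne (commute_resolvent_invSqrtOneAddSq hT)]

theorem commute_boundedTransform_resolvent_neg :
    Commute (boundedTransform hT) (resolvent hT (-Complex.I) neg_I_im_ne) := by
  rw [commute_iff_eq, resolvent_mul_boundedTransform,
    boundedTransform_mul_resolvent hT neg_I_im_ne (commute_resolvent_neg_invSqrtOneAddSq hT)]

theorem commute_boundedTransform_invSqrtOneAddSq :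
    Commute (boundedTransform hT) (invSqrtOneAddSq hT) :=
  commute_invSqrtOneAddSq_of_commute hT (commute_boundedTransform_resolvent hT)
    (commute_boundedTransform_resolvent_neg hT)

theorem boundedTransform_mul_invSqrtOneAddSq :
    boundedTransform hT * invSqrtOneAddSq hT
      = Complex.I • invOneAddSq hT - resolvent hT (-Complex.I) neg_I_im_ne := by
  ext x
  have h1 : invSqrtOneAddSq hT (invSqrtOneAddSq hT x)
      = resolvent hT Complex.I I_im_ne (resolvent hT (-Complex.I) neg_I_im_ne x) :=
    DFunLike.congr_fun (invSqrtOneAddSq_mul_self hT) x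
  change boundedTransform hT (invSqrtOneAddSq hT x) = _
  rw [boundedTransform_apply]
  simp_rw [h1]
  rw [apply_resolvent]
  rfl

theorem star_invOneAddSq : star (invOneAddSq hT) = invOneAddSq hT :=
  (IsSelfAdjoint.of_nonneg (invOneAddSq_nonneg hT)).star_eq

/-- The product `F Q = i P - R(-i)` is self-adjoint by the resolvent identity; as `F` commutes with
the injective operator `Q`, the factor `Q` can be cancelled. -/
theorem star_boundedTransform : star (boundedTransform hT) = boundedTransform hT := by
  have h1 : star (boundedTransform hT * invSqrtOneAddSq hT)
      = boundedTransform hT * invSqrtOneAddSq hT := by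
    rw [boundedTransform_mul_invSqrtOneAddSq, star_sub, star_smul, star_invOneAddSq,
      ← adjoint_resolvent, star_star, adjoint_resolvent, resolvent_neg_eq]
    simp only [RCLike.star_def, Complex.conj_I]
    module
  rw [star_mul, star_invSqrtOneAddSq, (commute_boundedTransform_invSqrtOneAddSq hT).eq] at h1
  exact invSqrtOneAddSq_mul_left_cancel hT h1

/-- After multiplication by `Q²` the claim becomes `(F Q)² = P - P²`, a computation with `F Q = i P
- R(-i)` and the resolvent identity. -/
theorem boundedTransform_mul_self :
    boundedTransform hT * boundedTransform hT = 1 - invOneAddSq hT := by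
  apply invSqrtOneAddSq_mul_left_cancel hT
  apply invSqrtOneAddSq_mul_left_cancel hT
  have hc := (commute_boundedTransform_invSqrtOneAddSq hT).eq
  have hK := boundedTransform_mul_invSqrtOneAddSq hT
  have hQ := invSqrtOneAddSq_mul_self hT
  have hP : invOneAddSq hT = resolvent hT Complex.I I_im_ne * resolvent hT (-Complex.I) neg_I_im_ne :=
    rfl
  have hR := resolvent_neg_eq hT
  have hPR : resolvent hT (-Complex.I) neg_I_im_ne * invOneAddSq hT
      = invOneAddSq hT * resolvent hT (-Complex.I) neg_I_im_ne := by
    rw [hP, ← mul_assoc, ← resolvent_comm]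
  set F := boundedTransform hT
  set Q := invSqrtOneAddSq hT
  set P := invOneAddSq hT
  set R' := resolvent hT (-Complex.I) neg_I_im_ne
  have h1 : R' * R' = P + (2 * Complex.I) • (P * R') := by
    conv_lhs => rw [hR]
    rw [add_mul, smul_mul_assoc, ← hR, ← hP]
  calc Q * (Q * (F * F)) = (F * Q) * (F * Q) := by
        rw [hc, mul_assoc Q F, ← mul_assoc F Q F, hc, mul_assoc Q F F]
    _ = P - P * P := by
        rw [hK]
        simp only [sub_mul, mul_sub, smul_mul_assoc, mul_smul_comm, smul_sub, smul_smul, hPR,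
          h1, Complex.I_mul_I]
        module
    _ = Q * (Q * (1 - P)) := by rw [← mul_assoc, hQ, mul_sub, mul_one]

end UnboundedOperator
-- The `C₀(ℝ)` functional calculus through the spectrum of the resolvent `(i - T)⁻¹`.
namespace UnboundedOperator

/-- The image of the extended real line under `x ↦ (i - x)⁻¹`. -/
def resolventCircle : Set ℂ := {z | Complex.normSq z + z.im = 0}

/-- The equation of the circle says that `z⁻¹` has imaginary part `1`. -/
theorem inv_eq_of_mem_resolventCircle {z : ℂ} (hz : z ∈ resolventCircle) (h0 : z ≠ 0) :
    z⁻¹ = Complex.I - ((-(z⁻¹).re : ℝ) : ℂ) := by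
  have h1 : Complex.normSq z ≠ 0 := by simpa using h0
  have h2 : z.im = -Complex.normSq z := by
    have : Complex.normSq z + z.im = 0 := hz
    linarith
  apply Complex.ext
  · simp
  · simp [Complex.inv_im, h2, h1]

theorem normSq_of_mem_resolventCircle {z : ℂ} (hz : z ∈ resolventCircle) (h0 : z ≠ 0) :
    Complex.normSq z * (1 + (z⁻¹).re ^ 2) = 1 := by
  have h1 : Complex.normSq z ≠ 0 := by simpa using h0
  have h2 : z.im = -Complex.normSq z := by
    have : Complex.normSq z + z.im = 0 := hz
    linarith
  have h3 : Complex.normSq z = z.re * z.re + z.im * z.im := Complex.normSq_apply z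
  rw [Complex.inv_re]
  field_simp
  rw [h2] at h3
  linarith

/-- The function on `resolventCircle` that corresponds to a function `φ` on the real line. -/
noncomputable def circleFun (φ : ℝ → ℂ) (z : ℂ) : ℂ := if z = 0 then 0 else φ (-(z⁻¹).re)

theorem circleFun_zero (φ : ℝ → ℂ) : circleFun φ 0 = 0 := if_pos rfl

theorem circleFun_of_ne {z : ℂ} (hz : z ≠ 0) (φ : ℝ → ℂ) : circleFun φ z = φ (-(z⁻¹).re) := if_neg hz

-- Only `z = 0` needs care: on the circle `|z⁻¹| ≤ 1 + |x|` for the corresponding real `x`, so `z →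
-- 0` forces `|x| → ∞`, where `φ` vanishes.
open Filter Topology in
theorem continuousOn_circleFun (φ : ZeroAtInftyContinuousMap ℝ ℂ) :
    ContinuousOn (circleFun φ) resolventCircle := by
  intro z hz
  by_cases h0 : z = 0
  · subst h0
    rw [ContinuousWithinAt, circleFun_zero, Metric.tendsto_nhdsWithin_nhds]
    intro ε hε
    have h1 : ∀ᶠ x in Bornology.cobounded ℝ, dist (φ x) 0 < ε := by
      rw [Metric.cobounded_eq_cocompact]
      exact (Metric.tendsto_nhds.mp φ.zero_at_infty') ε hε
    rw [← comap_norm_atTop, eventually_comap] at h1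
    obtain ⟨M, hM⟩ := eventually_atTop.mp h1
    refine ⟨1 / (|M| + 2), by positivity, fun {w} hw hwd => ?_⟩
    by_cases hw0 : w = 0
    · rwa [hw0, circleFun_zero, dist_self]
    rw [circleFun_of_ne hw0]
    refine hM _ ?_ _ rfl
    have h2 : ‖w⁻¹‖ ≤ 1 + ‖(-(w⁻¹).re : ℝ)‖ := by
      conv_lhs => rw [inv_eq_of_mem_resolventCircle hw hw0]
      refine (norm_sub_le _ _).trans ?_
      rw [Complex.norm_I, Complex.norm_real]
    have h3 : |M| + 2 < ‖w⁻¹‖ := by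
      rw [dist_zero_right] at hwd
      rw [norm_inv]
      rw [one_div] at hwd
      exact (lt_inv_comm₀ (norm_pos_iff.mpr hw0) (by positivity)).mp hwd
    linarith [le_abs_self M]
  · have h1 : ContinuousAt (fun w : ℂ => φ (-(w⁻¹).re)) z := by
      refine (map_continuous φ).continuousAt.comp ?_
      exact (Complex.continuous_re.continuousAt.comp (continuousAt_inv₀ h0)).neg
    refine (h1.congr ?_).continuousWithinAt
    filter_upwards [isOpen_ne.mem_nhds h0] with w hw
    rw [circleFun_of_ne hw]

variable {H : Type*} [NormedAddCommGroup H] [InnerProductSpace ℂ H] [CompleteSpace H]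
  {T : H →ₗ.[ℂ] H} (hT : IsSelfAdjoint T)

/-- The resolvent identity `R - R* = -2i R* R` forces `z - z̄ = -2i |z|²` on the spectrum, which is
the equation of the circle. -/
theorem spectrum_resolvent_subset :
    spectrum ℂ (resolvent hT Complex.I I_im_ne) ⊆ resolventCircle := by
  have hn := isStarNormal_resolvent hT
  have h1 := resolvent_sub_resolvent hT I_im_ne neg_I_im_ne
  have h2 : Set.EqOn (fun z : ℂ => star z * z)
      (fun z => (-Complex.I - Complex.I)⁻¹ • (z - star z))
      (spectrum ℂ (resolvent hT Complex.I I_im_ne)) := by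
    refine eqOn_of_cfc_eq_cfc (hf := by fun_prop) (hg := by fun_prop) (ha := hn) ?_
    rw [cfc_mul (fun z : ℂ => star z) (fun z => z) _, cfc_smul _ (fun z : ℂ => z - star z) _,
      cfc_sub (fun z : ℂ => z) (fun z => star z) _, cfc_star, cfc_id' ℂ _, adjoint_resolvent, h1,
      smul_smul, inv_mul_cancel₀, one_smul]
    intro h
    have := congrArg Complex.im h
    norm_num at this
  intro z hz
  have h3 := congrArg Complex.re (h2 hz)
  have h4 : (-Complex.I - Complex.I)⁻¹ = Complex.I / 2 := by
    have : -Complex.I - Complex.I = -(2 * Complex.I) := by ring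
    rw [this, inv_neg, mul_inv, Complex.inv_I]
    ring
  simp only [h4] at h3
  change Complex.normSq z + z.im = 0
  rw [Complex.normSq_apply]
  simp at h3
  linarith

theorem quasispectrum_resolvent_subset :
    quasispectrum ℂ (resolvent hT Complex.I I_im_ne) ⊆ resolventCircle := by
  rw [quasispectrum_eq_spectrum_union_zero]
  rintro z (hz | hz)
  · exact spectrum_resolvent_subset hT hz
  · rw [Set.mem_singleton_iff.mp hz]; simp [resolventCircle]

theorem c0Calculus_eq (φ : ZeroAtInftyContinuousMap ℝ ℂ) :
    c0Calculus hT φ = cfc (circleFun φ) (resolvent hT Complex.I I_im_ne) := by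
  unfold c0Calculus circleFun
  congr!

theorem continuousOn_circleFun_spectrum (φ : ZeroAtInftyContinuousMap ℝ ℂ) :
    ContinuousOn (circleFun φ) (spectrum ℂ (resolvent hT Complex.I I_im_ne)) :=
  (continuousOn_circleFun φ).mono (spectrum_resolvent_subset hT)

/-- The function on the circle vanishes at `0`, so the non-unital calculus applies and does not
leave `S`. -/
theorem c0Calculus_mem {S : NonUnitalStarSubalgebra ℂ (H →L[ℂ] H)} (hS : IsClosed (S : Set (H →L[ℂ] H)))
    (hR : resolvent hT Complex.I I_im_ne ∈ S) (φ : ZeroAtInftyContinuousMap ℝ ℂ) :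
    c0Calculus hT φ ∈ S := by
  have hn := isStarNormal_resolvent hT
  rw [c0Calculus_eq, ← cfcₙ_eq_cfc (hf := (continuousOn_circleFun φ).mono
    (quasispectrum_resolvent_subset hT)) (hf0 := circleFun_zero φ)]
  exact cfcₙ_mem _ hR

theorem c0Calculus_mul (φ ψ : ZeroAtInftyContinuousMap ℝ ℂ) :
    c0Calculus hT (φ * ψ) = c0Calculus hT φ * c0Calculus hT ψ := by
  have hn := isStarNormal_resolvent hT
  simp only [c0Calculus_eq]
  rw [← cfc_mul _ _ _ (continuousOn_circleFun_spectrum hT φ) (continuousOn_circleFun_spectrum hT ψ)]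
  refine cfc_congr fun z _ => ?_
  by_cases h : z = 0
  · simp [h, circleFun_zero]
  · simp [circleFun_of_ne h]

theorem c0Calculus_star (φ : ZeroAtInftyContinuousMap ℝ ℂ) :
    c0Calculus hT (star φ) = star (c0Calculus hT φ) := by
  simp only [c0Calculus_eq]
  rw [← cfc_star]
  refine cfc_congr fun z _ => ?_
  by_cases h : z = 0
  · simp [h, circleFun_zero]
  · simp [circleFun_of_ne h]

open Filter Topology in
/-- A continuous function dominated by an element of `C₀(ℝ)`, as an element of `C₀(ℝ)`. -/
def c0OfBound (φ : ZeroAtInftyContinuousMap ℝ ℂ) (h : ℝ → ℂ) (hc : Continuous h)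
    (hb : ∀ x, ‖h x‖ ≤ ‖φ x‖) : ZeroAtInftyContinuousMap ℝ ℂ where
  toFun := h
  continuous_toFun := hc
  zero_at_infty' := squeeze_zero_norm hb (by simpa using φ.zero_at_infty'.norm)

-- Splits `a φ(D) b` as `(a ψ₁(D)) (ψ₂(D) b)`, a product of elements of `B`. The factors are
-- `|φ|^(1/2)` and `φ / |φ|^(1/2)`.
open Filter Topology in
theorem exists_c0_factorization (φ : ZeroAtInftyContinuousMap ℝ ℂ) :
    ∃ ψ₁ ψ₂ : ZeroAtInftyContinuousMap ℝ ℂ, φ = ψ₁ * ψ₂ := by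
  have hs : Continuous fun x => Real.sqrt ‖φ x‖ := (map_continuous φ).norm.sqrt
  have hlim : Tendsto (fun x => Real.sqrt ‖φ x‖) (cocompact ℝ) (𝓝 0) := by
    simpa using φ.zero_at_infty'.norm.sqrt
  have hn : ∀ x, ‖φ x / (Real.sqrt ‖φ x‖ : ℂ)‖ = Real.sqrt ‖φ x‖ := fun x => by
    rw [norm_div, Complex.norm_real, Real.norm_of_nonneg (Real.sqrt_nonneg _), Real.div_sqrt]
  refine ⟨⟨⟨fun x => (Real.sqrt ‖φ x‖ : ℂ), by fun_prop⟩, ?_⟩,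
    ⟨⟨fun x => φ x / (Real.sqrt ‖φ x‖ : ℂ), ?_⟩, ?_⟩, ?_⟩
  · simpa using! (Complex.continuous_ofReal.tendsto 0).comp hlim
  -- At a zero of `φ` the quotient is `0 / 0 = 0`, and continuity there follows from its absolute
  -- value being `|φ|^(1/2)`.
  · rw [continuous_iff_continuousAt]
    intro x
    by_cases hx : φ x = 0
    · rw [ContinuousAt]
      simp only [hx, zero_div]
      refine squeeze_zero_norm (fun y => (hn y).le) ?_
      simpa [hx] using hs.tendsto x
    · have : (Real.sqrt ‖φ x‖ : ℂ) ≠ 0 := by simpa using hx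
      exact (map_continuous φ).continuousAt.div
        (Complex.continuous_ofReal.comp hs).continuousAt this
  · exact squeeze_zero_norm (fun y => (hn y).le) hlim
  · ext x
    change φ x = (Real.sqrt ‖φ x‖ : ℂ) * (φ x / (Real.sqrt ‖φ x‖ : ℂ))
    by_cases hx : φ x = 0
    · simp [hx]
    · have : (Real.sqrt ‖φ x‖ : ℂ) ≠ 0 := by simpa using hx
      rw [mul_div_cancel₀ _ this]

open Filter Topology in
theorem exists_c0Calculus_eq_invOneAddSq :
    ∃ φ : ZeroAtInftyContinuousMap ℝ ℂ, c0Calculus hT φ = invOneAddSq hT := by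
  have hn := isStarNormal_resolvent hT
  have hpos : ∀ x : ℝ, (1 + x ^ 2) ≠ 0 := fun x => by positivity
  have hc : Continuous fun x : ℝ => (1 + x ^ 2)⁻¹ := by fun_prop (disch := exact hpos _)
  have hlim : Tendsto (fun x : ℝ => (1 + x ^ 2)⁻¹) (cocompact ℝ) (𝓝 0) := by
    refine tendsto_inv_atTop_zero.comp (tendsto_atTop_add_const_left _ _ ?_)
    have := (tendsto_pow_atTop (two_ne_zero)).comp (tendsto_norm_cocompact_atTop (E := ℝ))
    simpa [Function.comp_def] using this
  let φ : ZeroAtInftyContinuousMap ℝ ℂ :=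
    ⟨⟨fun x => ((1 + x ^ 2)⁻¹ : ℝ), Complex.continuous_ofReal.comp hc⟩, by
      rw [← Complex.ofReal_zero]
      exact (Complex.continuous_ofReal.tendsto 0).comp hlim⟩
  refine ⟨φ, ?_⟩
  rw [c0Calculus_eq, invOneAddSq, ← adjoint_resolvent]
  conv_rhs => rw [← cfc_id' ℂ (resolvent hT Complex.I I_im_ne), ← cfc_star, ← cfc_mul ..]
  refine cfc_congr fun z hz => ?_
  by_cases h : z = 0
  · simp [h, circleFun_zero]
  · rw [circleFun_of_ne h]
    have h1 := normSq_of_mem_resolventCircle (spectrum_resolvent_subset hT hz) h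
    change (((1 + (-(z⁻¹).re) ^ 2)⁻¹ : ℝ) : ℂ) = z * (starRingEnd ℂ) z
    rw [Complex.mul_conj, neg_sq, eq_inv_of_mul_eq_one_left h1]

open ComplexOrder in
theorem invSqrtOneAddSq_eq_cfc :
    invSqrtOneAddSq hT = cfc (fun z : ℂ => (‖z‖ : ℂ)) (resolvent hT Complex.I I_im_ne) := by
  have hn := isStarNormal_resolvent hT
  refine CFC.sqrt_unique ?_ (cfc_nonneg fun z _ => by simp)
  rw [invOneAddSq, ← adjoint_resolvent, ← cfc_mul ..]
  conv_rhs => rw [← cfc_id' ℂ (resolvent hT Complex.I I_im_ne), ← cfc_star, ← cfc_mul ..]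
  refine cfc_congr fun z _ => ?_
  change (‖z‖ : ℂ) * ‖z‖ = z * (starRingEnd ℂ) z
  rw [Complex.mul_conj, Complex.normSq_eq_norm_sq]
  push_cast
  ring

/-- The symbol `x / √(1 + x²)` of `F` is bounded but not in `C₀(ℝ)`. Multiplication by the injective
`Q` brings in `F Q = i P - R(-i)`, which is a continuous function of the resolvent. -/
theorem exists_boundedTransform_mul_c0Calculus (φ : ZeroAtInftyContinuousMap ℝ ℂ) :
    ∃ ψ : ZeroAtInftyContinuousMap ℝ ℂ,
      boundedTransform hT * c0Calculus hT φ = c0Calculus hT ψ ∧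
      c0Calculus hT φ * boundedTransform hT = c0Calculus hT ψ := by
  have hn := isStarNormal_resolvent hT
  have hpos : ∀ x : ℝ, 0 < 1 + x ^ 2 := fun x => by positivity
  have hc : Continuous fun x : ℝ => x / Real.sqrt (1 + x ^ 2) := by
    fun_prop (disch := exact fun x => (Real.sqrt_pos.mpr (hpos x)).ne')
  have hb : ∀ x : ℝ, ‖x / Real.sqrt (1 + x ^ 2)‖ ≤ 1 := fun x => by
    rw [norm_div, Real.norm_of_nonneg (Real.sqrt_nonneg _),
      div_le_one (Real.sqrt_pos.mpr (hpos x))]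
    exact Real.abs_le_sqrt (by linarith)
  let ψ := c0OfBound φ (fun x => (x / Real.sqrt (1 + x ^ 2) : ℝ) * φ x)
    ((Complex.continuous_ofReal.comp hc).mul (map_continuous φ)) fun x => by
      rw [norm_mul, Complex.norm_real]
      exact mul_le_of_le_one_left (norm_nonneg _) (hb x)
  have h1 : boundedTransform hT * c0Calculus hT φ = c0Calculus hT ψ := by
    apply invSqrtOneAddSq_mul_left_cancel hT
    rw [← mul_assoc, ← (commute_boundedTransform_invSqrtOneAddSq hT).eq,
      boundedTransform_mul_invSqrtOneAddSq, invOneAddSq, ← adjoint_resolvent,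
      invSqrtOneAddSq_eq_cfc, c0Calculus_eq, c0Calculus_eq]
    rw [← cfc_mul _ _ _ (by fun_prop) (continuousOn_circleFun_spectrum hT ψ)]
    have h2 : Complex.I • (resolvent hT Complex.I I_im_ne * star (resolvent hT Complex.I I_im_ne))
        - star (resolvent hT Complex.I I_im_ne) = cfc (fun z : ℂ => Complex.I • (z * star z) - star z)
          (resolvent hT Complex.I I_im_ne) := by
      rw [cfc_sub _ (fun z : ℂ => star z) _, cfc_smul _ (fun z : ℂ => z * star z),
        cfc_mul (fun z : ℂ => z) (fun z => star z), cfc_star, cfc_id' ℂ _]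
    rw [h2, ← cfc_mul _ _ _ (by fun_prop) (continuousOn_circleFun_spectrum hT φ)]
    refine cfc_congr fun z hz => ?_
    by_cases h : z = 0
    · simp [h, circleFun_zero]
    have hz' := spectrum_resolvent_subset hT hz
    have h3 := normSq_of_mem_resolventCircle hz' h
    have h4 := inv_eq_of_mem_resolventCircle hz' h
    simp only [circleFun_of_ne h]
    set x : ℝ := -(z⁻¹).re with hx
    have h5 : (z⁻¹).re ^ 2 = x ^ 2 := by rw [hx, neg_sq]
    rw [h5] at h3
    change (Complex.I * (z * (starRingEnd ℂ) z) - (starRingEnd ℂ) z) * φ x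
      = ‖z‖ * ((x / Real.sqrt (1 + x ^ 2) : ℝ) * φ x)
    -- With `√(1 + x²) = |z|⁻¹` this gives `i |z|² - z̄ = x |z|² = |z| · x / √(1 + x²)`.
    have h6 : (starRingEnd ℂ) z = (Complex.I - x) * Complex.normSq z := by
      rw [← h4, ← Complex.mul_conj, inv_mul_cancel_left₀ h]
    have h7 : Real.sqrt (1 + x ^ 2) = ‖z‖⁻¹ := by
      rw [Real.sqrt_eq_iff_mul_self_eq (hpos x).le (by positivity), ← mul_inv, ← sq,
        ← Complex.normSq_eq_norm_sq, eq_inv_of_mul_eq_one_right h3]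
    rw [Complex.mul_conj, h6, h7, Complex.normSq_eq_norm_sq]
    push_cast
    rw [div_inv_eq_mul]
    ring
  refine ⟨ψ, h1, ?_⟩
  rw [← h1, c0Calculus_eq]
  have h2 := (commute_boundedTransform_resolvent hT).symm.cfc (by
    rw [adjoint_resolvent]; exact (commute_boundedTransform_resolvent_neg hT).symm) (circleFun φ)
  exact h2.eq

end UnboundedOperator
-- The commutator of the bounded transform with an operator that has a bounded commutator with `T`.
namespace UnboundedOperator

variable {H : Type*} [NormedAddCommGroup H] [InnerProductSpace ℂ H] [CompleteSpace H]
  {T : H →ₗ.[ℂ] H} (hT : IsSelfAdjoint T)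

/-- Formally `Q (T a - a T) Q` with `T Q = F = Q T`. Inner products are taken since `Q T` makes
sense only on the domain of `T`. -/
theorem invSqrt_mul_commutator_mul_invSqrt {a C : H →L[ℂ] H} (ha : ∀ x : T.domain, a x ∈ T.domain)
    (hC : ∀ x : T.domain, C x = T ⟨a x, ha x⟩ - a (T x)) :
    invSqrtOneAddSq hT * C * invSqrtOneAddSq hT
      = boundedTransform hT * a * invSqrtOneAddSq hT
        - invSqrtOneAddSq hT * a * boundedTransform hT := by
  ext x
  refine ext_inner_left ℂ fun y => ?_
  set Q := invSqrtOneAddSq hT with hQ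
  set F := boundedTransform hT with hF
  have hQs : ∀ u v, inner ℂ u (Q v) = inner ℂ (Q u) v := fun u v => by
    have h := ContinuousLinearMap.adjoint_inner_left Q v u
    rw [← ContinuousLinearMap.star_eq_adjoint, hQ, star_invSqrtOneAddSq] at h
    exact h.symm
  have hFs : ∀ u v, inner ℂ u (F v) = inner ℂ (F u) v := fun u v => by
    have h := ContinuousLinearMap.adjoint_inner_left F v u
    rw [← ContinuousLinearMap.star_eq_adjoint, hF, star_boundedTransform] at h
    exact h.symm
  change inner ℂ y (Q (C (Q x))) = inner ℂ y (F (a (Q x)) - Q (a (F x)))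
  have h1 := hC ⟨Q x, invSqrtOneAddSq_mem hT x⟩
  rw [← boundedTransform_apply] at h1
  have h2 := symm_apply hT ⟨Q y, invSqrtOneAddSq_mem hT y⟩
    ⟨a (Q x), ha ⟨Q x, invSqrtOneAddSq_mem hT x⟩⟩
  rw [← boundedTransform_apply] at h2
  simp only at h1 h2
  rw [hQs, h1, inner_sub_right, inner_sub_right, ← h2, hFs, hQs]

/-- The commutator of the phase `G = F + i (1 + T²)^(-1/2)` of `T + i` with `a` solves a Sylvester
equation. -/
theorem sylvester_phase {a C : H →L[ℂ] H} (ha : ∀ x : T.domain, a x ∈ T.domain)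
    (hC : ∀ x : T.domain, C x = T ⟨a x, ha x⟩ - a (T x)) {G : H →L[ℂ] H}
    (hG : G = boundedTransform hT + Complex.I • invSqrtOneAddSq hT) :
    G * star G = 1 ∧ star G * G = 1 ∧
    (a - star G * a * G) * invSqrtOneAddSq hT + invSqrtOneAddSq hT * (a - star G * a * G)
      = invSqrtOneAddSq hT * (star G * C - C * G) * invSqrtOneAddSq hT := by
  have hQCQ := invSqrt_mul_commutator_mul_invSqrt hT ha hC
  have hcFQ := (commute_boundedTransform_invSqrtOneAddSq hT).eq
  have hFF := boundedTransform_mul_self hT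
  have hQQ := invSqrtOneAddSq_mul_self hT
  have hGs : star G = boundedTransform hT - Complex.I • invSqrtOneAddSq hT := by
    rw [hG, star_add, star_smul, star_boundedTransform, star_invSqrtOneAddSq, RCLike.star_def,
      Complex.conj_I, neg_smul, sub_eq_add_neg]
  set Q := invSqrtOneAddSq hT
  set F := boundedTransform hT
  have h1 : G * star G = 1 := by
    rw [hGs, hG]
    simp only [mul_sub, add_mul, smul_mul_assoc, mul_smul_comm, smul_smul, smul_add,
      Complex.I_mul_I, hFF, hQQ, hcFQ]
    module
  have h2 : star G * G = 1 := by
    rw [hGs, hG]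
    simp only [mul_add, sub_mul, smul_mul_assoc, mul_smul_comm, smul_smul, smul_sub,
      Complex.I_mul_I, hFF, hQQ, hcFQ]
    module
  -- The contributions `± i Q a Q` of the imaginary part cancel, so `F` may be replaced by `G` or by
  -- `star G`.
  have h3 : G * a * Q - Q * a * G = Q * C * Q := by
    rw [hQCQ, hG]
    simp only [mul_add, add_mul, smul_mul_assoc, mul_smul_comm]
    abel
  have h4 : star G * a * Q - Q * a * star G = Q * C * Q := by
    rw [hQCQ, hGs]
    simp only [mul_sub, sub_mul, smul_mul_assoc, mul_smul_comm]
    abel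
  have hcG : G * Q = Q * G := by rw [hG, add_mul, mul_add, hcFQ, smul_mul_assoc, mul_smul_comm]
  have hcG' : star G * Q = Q * star G := by
    rw [hGs, sub_mul, mul_sub, hcFQ, smul_mul_assoc, mul_smul_comm]
  refine ⟨h1, h2, ?_⟩
  -- `h3` times `star G` from the left; below, `h4` times `G` from the right. The difference of the
  -- two is the claim.
  have h5 : a * Q - Q * (star G * a * G) = Q * (star G * C) * Q := by
    calc a * Q - Q * (star G * a * G) = star G * (G * a * Q - Q * a * G) := by
          simp only [mul_sub, ← mul_assoc, h2, one_mul, hcG']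
      _ = _ := by rw [h3]; simp only [← mul_assoc, hcG']
  have h6 : star G * a * G * Q - Q * a = Q * (C * G) * Q := by
    calc star G * a * G * Q - Q * a = (star G * a * Q - Q * a * star G) * G := by
          rw [sub_mul, mul_assoc (Q * a), h2, mul_one, mul_assoc _ G, hcG, ← mul_assoc]
      _ = _ := by rw [h4, mul_assoc _ Q, ← hcG]; simp only [← mul_assoc]
  rw [sub_mul, mul_sub, mul_sub, sub_mul, ← h5, ← h6]
  abel

end UnboundedOperator

/-- A multiplier `X` of a closed *-algebra `S` that solves `X Q + Q X = Q Y Q`, where `0 ≤ Q ∈ S` has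
dense range, belongs to `S`. -/
theorem mem_of_mul_add_mul_eq {H : Type*} [NormedAddCommGroup H] [InnerProductSpace ℂ H]
    [CompleteSpace H] {S : NonUnitalStarSubalgebra ℂ (H →L[ℂ] H)}
    (hS : IsClosed (S : Set (H →L[ℂ] H))) {Q X Y : H →L[ℂ] H} (hQ : 0 ≤ Q) (hd : DenseRange Q)
    (hQS : Q ∈ S) (hX : X ∈ S.idealizer) (h : X * Q + Q * X = Q * Y * Q) : X ∈ S := by
  have hQs : IsSelfAdjoint Q := .of_nonneg hQ
  rw [← SetLike.mem_coe, ← hS.closure_eq, Metric.mem_closure_iff]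
  intro ε hε
  set δ := ε / (‖Y‖ + 1) with hδ
  have hδ0 : 0 < δ := by positivity
  set k := cfc (highCutoff δ) Q with hk
  -- `1 - highCutoff δ` vanishes at `0`, so the non-unital calculus keeps it in `S`. Each term of `X
  -- - k X k` then has a factor `1 - k`.
  have hm : 1 - k ∈ S := by
    have h1 : 1 - k = cfcₙ (fun x => 1 - highCutoff δ x) Q := by
      have hc : Continuous fun x => 1 - highCutoff δ x :=
        continuous_const.sub (continuous_highCutoff δ)
      rw [cfcₙ_eq_cfc (hf := hc.continuousOn) (hf0 := by simp [highCutoff]),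
        cfc_sub _ _ Q continuousOn_const (continuous_highCutoff δ).continuousOn,
        cfc_const_one ℝ Q]
    rw [h1]
    exact cfcₙ_mem _ hQS
  refine ⟨X - k * X * k, ?_, ?_⟩
  · have h2 : X - k * X * k = (1 - k) * X + X * (1 - k) - (1 - k) * (X * (1 - k)) := by
      noncomm_ring
    rw [h2]
    exact sub_mem (add_mem (hX _ hm).2 (hX _ hm).1) (mul_mem hm (hX _ hm).1)
  · rw [dist_eq_norm, sub_sub_cancel]
    refine (norm_highCutoff_compress_le hQ hd h hδ0).trans_lt ?_
    rw [hδ]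
    have h3 : 0 < ‖Y‖ + 1 := by positivity
    calc ε / (‖Y‖ + 1) / 2 * ‖Y‖ < ε / (‖Y‖ + 1) * (‖Y‖ + 1) := by
          have : 0 < ε / (‖Y‖ + 1) := hδ0
          nlinarith [norm_nonneg Y]
      _ = ε := by field_simp

namespace UnboundedOperator

variable {H : Type*} [NormedAddCommGroup H] [InnerProductSpace ℂ H] [CompleteSpace H]
  {T : H →ₗ.[ℂ] H} (hT : IsSelfAdjoint T)

theorem invSqrtOneAddSq_mem_of_resolvent_mem {S : NonUnitalStarSubalgebra ℂ (H →L[ℂ] H)}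
    (hS : IsClosed (S : Set (H →L[ℂ] H))) (hR : resolvent hT Complex.I I_im_ne ∈ S) :
    invSqrtOneAddSq hT ∈ S := by
  have hn := isStarNormal_resolvent hT
  rw [invSqrtOneAddSq_eq_cfc, ← cfcₙ_eq_cfc]
  exact cfcₙ_mem _ hR

/-- If `a` has a bounded commutator with `T`, then `[F_T, a]` belongs to every closed *-algebra that
contains the resolvent of `T` and of which `F_T` and `a` are multipliers. -/
theorem commutator_boundedTransform_mem {S : NonUnitalStarSubalgebra ℂ (H →L[ℂ] H)}
    (hS : IsClosed (S : Set (H →L[ℂ] H))) (hR : resolvent hT Complex.I I_im_ne ∈ S)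
    (hF : boundedTransform hT ∈ S.idealizer) {a C : H →L[ℂ] H} (haS : a ∈ S.idealizer)
    (ha : ∀ x : T.domain, a x ∈ T.domain)
    (hC : ∀ x : T.domain, C x = T ⟨a x, ha x⟩ - a (T x)) :
    boundedTransform hT * a - a * boundedTransform hT ∈ S := by
  obtain ⟨h1, h2, h3⟩ := sylvester_phase hT ha hC rfl
  have hQ := invSqrtOneAddSq_mem_of_resolvent_mem hT hS hR
  set G := boundedTransform hT + Complex.I • invSqrtOneAddSq hT with hG
  have hGS : G ∈ S.idealizer := add_mem hF (S.idealizer.smul_mem (S.le_idealizer hQ) _)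
  have hX := mem_of_mul_add_mul_eq hS (invSqrtOneAddSq_nonneg hT) (denseRange_invSqrtOneAddSq hT) hQ
    (sub_mem haS (mul_mem (mul_mem (star_mem hGS) haS) hGS)) h3
  -- As `G` is unitary, `G (a - G* a G) = [G, a]`, and `F = G - i Q`.
  have h4 : boundedTransform hT * a - a * boundedTransform hT = G * (a - star G * a * G)
      - Complex.I • (invSqrtOneAddSq hT * a - a * invSqrtOneAddSq hT) := by
    rw [mul_sub, ← mul_assoc, ← mul_assoc, h1, one_mul, hG, add_mul, mul_add, smul_mul_assoc,
      mul_smul_comm]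
    module
  rw [h4]
  exact sub_mem (hGS _ hX).1 (SMulMemClass.smul_mem _ (sub_mem (haS _ hQ).2 (haS _ hQ).1))

end UnboundedOperator
-- Von Neumann algebras, their ideals, and multipliers of a generated C*-algebra.
-- The commutant is a C*-algebra, hence spanned by its unitaries; the bicommutant theorem does the
-- rest.
theorem VonNeumannAlgebra.mem_of_forall_unitary_commute {H : Type*} [NormedAddCommGroup H]
    [InnerProductSpace ℂ H] [CompleteSpace H] (N : VonNeumannAlgebra H) {x : H →L[ℂ] H}
    (h : ∀ U ∈ unitary (H →L[ℂ] H), U ∈ N.commutant → U * x = x * U) : x ∈ N := by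
  rw [← N.commutant_commutant, VonNeumannAlgebra.mem_commutant_iff]
  intro g hg
  let S : StarSubalgebra ℂ (H →L[ℂ] H) := N.commutant.toStarSubalgebra
  have hgS : g ∈ S := hg
  have hS : IsClosed (S : Set (H →L[ℂ] H)) := by
    change IsClosed (N.commutant : Set (H →L[ℂ] H))
    rw [VonNeumannAlgebra.coe_commutant]
    exact Set.isClosed_centralizer _
  have h1 : (⟨g, hgS⟩ : S) ∈ Submodule.span ℂ (unitary S : Set S) := by
    rw [CStarAlgebra.span_unitary]; trivial
  have h2 : ∀ u ∈ Submodule.span ℂ (unitary S : Set S), (u : H →L[ℂ] H) * x = x * u := by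
    intro u hu
    induction hu using Submodule.span_induction with
    | mem u hu =>
      refine h u ⟨?_, ?_⟩ u.2
      · exact congrArg Subtype.val hu.1
      · exact congrArg Subtype.val hu.2
    | zero => simp
    | add u v _ _ hu hv =>
      change ((u : H →L[ℂ] H) + v) * x = x * ((u : H →L[ℂ] H) + v)
      rw [add_mul, mul_add, hu, hv]
    | smul c u _ hu =>
      change (c • (u : H →L[ℂ] H)) * x = x * (c • (u : H →L[ℂ] H))
      rw [smul_mul_assoc, mul_smul_comm, hu]
  exact h2 _ h1

/-- The largest *-invariant subset of a two-sided ideal of a von Neumann algebra. -/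
def idealStarCore {H : Type*} [NormedAddCommGroup H] [InnerProductSpace ℂ H] [CompleteSpace H]
    {N : VonNeumannAlgebra H} (J : Ideal N) : NonUnitalStarSubalgebra ℂ (H →L[ℂ] H) where
  carrier := {x | x ∈ idealCarrier J ∧ star x ∈ idealCarrier J}
  zero_mem' := by
    have h : (0 : H →L[ℂ] H) ∈ idealCarrier J := ⟨0, J.zero_mem, rfl⟩
    exact ⟨h, by rwa [star_zero]⟩
  add_mem' := by
    have h : ∀ x y, x ∈ idealCarrier J → y ∈ idealCarrier J → x + y ∈ idealCarrier J := by
      rintro _ _ ⟨x, hx, rfl⟩ ⟨y, hy, rfl⟩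
      exact ⟨x + y, J.add_mem hx hy, rfl⟩
    rintro x y ⟨hx, hx'⟩ ⟨hy, hy'⟩
    exact ⟨h _ _ hx hy, by rw [star_add]; exact h _ _ hx' hy'⟩
  mul_mem' := by
    have h : ∀ x y, x ∈ idealCarrier J → y ∈ idealCarrier J → x * y ∈ idealCarrier J := by
      rintro _ _ ⟨x, hx, rfl⟩ ⟨y, hy, rfl⟩
      exact ⟨x * y, J.mul_mem_left x hy, rfl⟩
    rintro x y ⟨hx, hx'⟩ ⟨hy, hy'⟩
    exact ⟨h _ _ hx hy, by rw [star_mul]; exact h _ _ hy' hx'⟩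
  smul_mem' := by
    have h : ∀ (c : ℂ) x, x ∈ idealCarrier J → c • x ∈ idealCarrier J := by
      rintro c _ ⟨x, hx, rfl⟩
      have hc : c • (1 : H →L[ℂ] H) ∈ N :=
        N.toStarSubalgebra.smul_mem N.toStarSubalgebra.one_mem c
      refine ⟨⟨_, hc⟩ * x, J.mul_mem_left _ hx, ?_⟩
      change (c • (1 : H →L[ℂ] H)) * x = _
      rw [smul_mul_assoc, one_mul]
    rintro c x ⟨hx, hx'⟩
    exact ⟨h _ _ hx, by rw [star_smul]; exact h _ _ hx'⟩
  star_mem' := by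
    rintro x ⟨hx, hx'⟩
    exact ⟨hx', by rwa [star_star]⟩

theorem isClosed_idealStarCore {H : Type*} [NormedAddCommGroup H] [InnerProductSpace ℂ H]
    [CompleteSpace H] {N : VonNeumannAlgebra H} {J : Ideal N} (hJ : IsClosed (idealCarrier J)) :
    IsClosed (idealStarCore J : Set (H →L[ℂ] H)) :=
  hJ.inter (hJ.preimage continuous_star)

theorem mem_idealizer_idealStarCore {H : Type*} [NormedAddCommGroup H] [InnerProductSpace ℂ H]
    [CompleteSpace H] {N : VonNeumannAlgebra H} {J : Ideal N} (hJ : J.IsTwoSided) {t : H →L[ℂ] H}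
    (ht : t ∈ N) : t ∈ (idealStarCore J).idealizer := by
  have hl : ∀ t ∈ N, ∀ x ∈ idealCarrier J, t * x ∈ idealCarrier J := by
    rintro t ht _ ⟨x, hx, rfl⟩
    exact ⟨⟨t, ht⟩ * x, J.mul_mem_left _ hx, rfl⟩
  have hr : ∀ t ∈ N, ∀ x ∈ idealCarrier J, x * t ∈ idealCarrier J := by
    rintro t ht _ ⟨x, hx, rfl⟩
    exact ⟨x * ⟨t, ht⟩, J.mul_mem_right _ hx, rfl⟩
  rintro x ⟨hx, hx'⟩
  refine ⟨⟨hl t ht x hx, ?_⟩, ⟨hr t ht x hx, ?_⟩⟩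
  · rw [star_mul]; exact hr _ (star_mem ht) _ hx'
  · rw [star_mul]; exact hl _ (star_mem ht) _ hx'

/-- Being a multiplier can be tested on generators. Both `w` and `star w` must be tested, since
taking adjoints of elements of the algebra exchanges them. -/
theorem NonUnitalStarSubalgebra.mem_idealizer_closure_adjoin {A : Type*} [CStarAlgebra A] {s : Set A}
    {w : A} (h : ∀ x ∈ s, ∀ v, v = w ∨ v = star w →
      v * x ∈ (NonUnitalStarAlgebra.adjoin ℂ s).topologicalClosure ∧
      x * v ∈ (NonUnitalStarAlgebra.adjoin ℂ s).topologicalClosure) :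
    w ∈ (NonUnitalStarAlgebra.adjoin ℂ s).topologicalClosure.idealizer := by
  set B := (NonUnitalStarAlgebra.adjoin ℂ s).topologicalClosure with hB
  have hcl : IsClosed (B : Set A) := NonUnitalStarSubalgebra.isClosed_topologicalClosure _
  have key : ∀ x ∈ NonUnitalStarAlgebra.adjoin ℂ s,
      x ∈ B ∧ ∀ v, v = w ∨ v = star w → v * x ∈ B ∧ x * v ∈ B := by
    intro x hx
    refine ⟨NonUnitalStarSubalgebra.le_topologicalClosure _ hx, ?_⟩
    induction hx using NonUnitalStarAlgebra.adjoin_induction with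
    | mem x hx => exact h x hx
    | zero => intro v _; simp [zero_mem]
    | add x y _ _ hx hy =>
      intro v hv
      rw [mul_add, add_mul]
      exact ⟨add_mem (hx v hv).1 (hy v hv).1, add_mem (hx v hv).2 (hy v hv).2⟩
    | mul x y hx' hy' hx hy =>
      intro v hv
      rw [← mul_assoc, mul_assoc x]
      exact ⟨mul_mem (hx v hv).1 (NonUnitalStarSubalgebra.le_topologicalClosure _ hy'),
        mul_mem (NonUnitalStarSubalgebra.le_topologicalClosure _ hx') (hy v hv).2⟩
    | smul c x _ hx =>
      intro v hv
      rw [mul_smul_comm, smul_mul_assoc]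
      exact ⟨SMulMemClass.smul_mem _ (hx v hv).1, SMulMemClass.smul_mem _ (hx v hv).2⟩
    | star x _ hx =>
      intro v hv
      have hv' : star v = w ∨ star v = star w := by
        rcases hv with rfl | rfl
        · exact .inr rfl
        · exact .inl (star_star _)
      have h1 := star_mem (hx _ hv').1
      have h2 := star_mem (hx _ hv').2
      rw [star_mul, star_star] at h1 h2
      exact ⟨h2, h1⟩
  have h1 : (B : Set A) ⊆ {x | w * x ∈ B} ∩ {x | x * w ∈ B} := by
    refine closure_minimal (fun x hx => ((key x hx).2 w (.inl rfl))) (IsClosed.inter ?_ ?_)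
    · exact hcl.preimage (continuous_const.mul continuous_id)
    · exact hcl.preimage (continuous_id.mul continuous_const)
  exact fun x hx => h1 hx

/-! ### The inclusion `B ⊆ J` and the separability of `B`. -/

namespace VonNeumannSpectralTriple

open UnboundedOperator

variable {𝒜 : Type*} [NonUnitalRing 𝒜] [StarRing 𝒜] [Module ℂ 𝒜]
  [IsScalarTower ℂ 𝒜 𝒜] [SMulCommClass ℂ 𝒜 𝒜] [StarModule ℂ 𝒜]
  {H : Type*} [NormedAddCommGroup H] [InnerProductSpace ℂ H] [CompleteSpace H]
  {N : VonNeumannAlgebra H} {J : Ideal N} (X : VonNeumannSpectralTriple 𝒜 N J)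

theorem resolvent_mem_idealCarrier (hX : X.IsUnital) {z : ℂ} (hz : z.im ≠ 0) :
    resolvent X.isSelfAdjoint z hz ∈ idealCarrier J := by
  obtain ⟨e, he⟩ := hX
  have h := X.resolvent_mem e z hz
  rwa [he, one_mul] at h

theorem resolvent_mem_idealStarCore (hX : X.IsUnital) :
    resolvent X.isSelfAdjoint Complex.I I_im_ne ∈ idealStarCore J :=
  ⟨X.resolvent_mem_idealCarrier hX _, by
    rw [adjoint_resolvent]; exact X.resolvent_mem_idealCarrier hX _⟩

/-- The resolvents lie in `J ⊆ N`, so a unitary `U` of the commutant commutes with them and with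
`Q`; affiliation gives `U D Q = D U Q = D Q U`. -/
theorem F_mem (hX : X.IsUnital) : X.F ∈ N := by
  refine N.mem_of_forall_unitary_commute fun U hU hUN => ?_
  have hmem : ∀ (z : ℂ) (hz : z.im ≠ 0), Commute U (resolvent X.isSelfAdjoint z hz) := by
    intro z hz
    obtain ⟨r, -, hr⟩ := X.resolvent_mem_idealCarrier hX hz
    rw [← hr]
    exact (VonNeumannAlgebra.mem_commutant_iff.mp hUN r r.2).symm
  have hQ := commute_invSqrtOneAddSq_of_commute X.isSelfAdjoint (hmem _ _) (hmem _ _)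
  ext x
  change U (boundedTransform X.isSelfAdjoint x) = boundedTransform X.isSelfAdjoint (U x)
  rw [boundedTransform_apply, boundedTransform_apply]
  obtain ⟨h1, h2⟩ := X.affiliated U hU hUN ⟨_, invSqrtOneAddSq_mem X.isSelfAdjoint x⟩
  rw [← h2]
  congr 1
  exact Subtype.ext (DFunLike.congr_fun hQ.eq x)

theorem commF_mem_idealStarCore (hX : X.IsUnital) (a : 𝒜) : X.commF a ∈ idealStarCore J := by
  obtain ⟨h, C, hC⟩ := X.bounded_commutator a
  exact commutator_boundedTransform_mem X.isSelfAdjoint (isClosed_idealStarCore X.isClosed)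
    (X.resolvent_mem_idealStarCore hX) (mem_idealizer_idealStarCore X.isTwoSided (X.F_mem hX))
    (mem_idealizer_idealStarCore X.isTwoSided (X.π_mem a)) h hC

theorem B_le_idealStarCore (hX : X.IsUnital) : X.B ≤ idealStarCore J := by
  refine NonUnitalStarSubalgebra.topologicalClosure_minimal _ (NonUnitalStarAlgebra.adjoin_le ?_)
    (isClosed_idealStarCore X.isClosed)
  have hF := mem_idealizer_idealStarCore X.isTwoSided (X.F_mem hX)
  have hπ := fun a => mem_idealizer_idealStarCore X.isTwoSided (X.π_mem a)
  have hk := X.commF_mem_idealStarCore hX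
  rintro T (((⟨a, rfl⟩ | ⟨a, b, rfl⟩) | ⟨a, b, rfl⟩) | ⟨a, φ, rfl⟩)
  · exact (hF _ (hk a)).1
  · exact (hπ b _ (hk a)).1
  · rw [mul_assoc]; exact (hF _ (hπ b _ (hk a)).1).1
  · exact (hπ a _ (c0Calculus_mem _ (isClosed_idealStarCore X.isClosed)
      (X.resolvent_mem_idealStarCore hX) φ)).1

/-- The generators are continuous images of products of two separable sets: the image of `𝒜`, and
the `φ(D)`, which lie in the C*-algebra generated by a single resolvent. -/
theorem isSeparable_B (hsep : TopologicalSpace.IsSeparable (X.A : Set (H →L[ℂ] H))) :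
    TopologicalSpace.IsSeparable (X.B : Set (H →L[ℂ] H)) := by
  have hπ : TopologicalSpace.IsSeparable (Set.range X.π) :=
    hsep.mono fun x hx => NonUnitalStarSubalgebra.le_topologicalClosure _ (by simpa using hx)
  have hk : TopologicalSpace.IsSeparable (Set.range X.commF) := by
    have h : Continuous fun t : H →L[ℂ] H => X.F * t - t * X.F := by fun_prop
    refine (hπ.image h).mono ?_
    rintro _ ⟨a, rfl⟩
    exact ⟨_, ⟨a, rfl⟩, rfl⟩
  have hbk := (hπ.prod hk).image continuous_mul
  have hF : Continuous fun t : H →L[ℂ] H => X.F * t := by fun_prop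
  have hc0 : TopologicalSpace.IsSeparable (Set.range (c0Calculus X.isSelfAdjoint)) := by
    have h := (TopologicalSpace.IsSeparable.of_subtype
      {resolvent X.isSelfAdjoint Complex.I I_im_ne}).nonUnitalStarAlgebra_adjoin.closure
    refine h.mono ?_
    rintro _ ⟨φ, rfl⟩
    exact c0Calculus_mem X.isSelfAdjoint
      (S := (NonUnitalStarAlgebra.adjoin ℂ
        {resolvent X.isSelfAdjoint Complex.I I_im_ne}).topologicalClosure)
      (NonUnitalStarSubalgebra.isClosed_topologicalClosure _)
      (NonUnitalStarSubalgebra.le_topologicalClosure _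
        (NonUnitalStarAlgebra.self_mem_adjoin_singleton ℂ _)) φ
  have hgen := (((hk.image hF).union hbk).union (hbk.image hF)).union
    ((hπ.prod hc0).image continuous_mul)
  refine TopologicalSpace.IsSeparable.closure
    (TopologicalSpace.IsSeparable.nonUnitalStarAlgebra_adjoin (hgen.mono ?_))
  rintro T (((⟨a, rfl⟩ | ⟨a, b, rfl⟩) | ⟨a, b, rfl⟩) | ⟨a, φ, rfl⟩)
  · exact .inl (.inl (.inl ⟨_, ⟨a, rfl⟩, rfl⟩))
  · exact .inl (.inl (.inr ⟨(_, _), ⟨⟨b, rfl⟩, ⟨a, rfl⟩⟩, rfl⟩))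
  · exact .inl (.inr ⟨_, ⟨(_, _), ⟨⟨b, rfl⟩, ⟨a, rfl⟩⟩, rfl⟩, (mul_assoc _ _ _).symm⟩)
  · exact .inr ⟨(_, _), ⟨⟨a, rfl⟩, ⟨φ, rfl⟩⟩, rfl⟩

end VonNeumannSpectralTriple
-- `F` and `A` are multipliers of `B`, with defects in `B`.
namespace VonNeumannSpectralTriple

open UnboundedOperator

variable {𝒜 : Type*} [NonUnitalRing 𝒜] [StarRing 𝒜] [Module ℂ 𝒜]
  [IsScalarTower ℂ 𝒜 𝒜] [SMulCommClass ℂ 𝒜 𝒜] [StarModule ℂ 𝒜]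
  {H : Type*} [NormedAddCommGroup H] [InnerProductSpace ℂ H] [CompleteSpace H]
  {N : VonNeumannAlgebra H} {J : Ideal N} (X : VonNeumannSpectralTriple 𝒜 N J)

theorem generators_subset_B {T : H →L[ℂ] H} (hT : T ∈ X.generators) : T ∈ X.B :=
  NonUnitalStarSubalgebra.le_topologicalClosure _ (NonUnitalStarAlgebra.subset_adjoin ℂ _ hT)

theorem F_mul_commF_mem (a : 𝒜) : X.F * X.commF a ∈ X.B :=
  X.generators_subset_B (.inl (.inl (.inl ⟨a, rfl⟩)))

theorem π_mul_commF_mem (b a : 𝒜) : X.π b * X.commF a ∈ X.B :=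
  X.generators_subset_B (.inl (.inl (.inr ⟨a, b, rfl⟩)))

theorem F_mul_π_mul_commF_mem (b a : 𝒜) : X.F * (X.π b * X.commF a) ∈ X.B := by
  rw [← mul_assoc]
  exact X.generators_subset_B (.inl (.inr ⟨a, b, rfl⟩))

theorem π_mul_c0Calculus_mem (a : 𝒜) (φ : ZeroAtInftyContinuousMap ℝ ℂ) :
    X.π a * c0Calculus X.isSelfAdjoint φ ∈ X.B :=
  X.generators_subset_B (.inr ⟨a, φ, rfl⟩)

theorem c0Calculus_mul_π_mem (φ : ZeroAtInftyContinuousMap ℝ ℂ) (a : 𝒜) :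
    c0Calculus X.isSelfAdjoint φ * X.π a ∈ X.B := by
  have h := star_mem (X.π_mul_c0Calculus_mem (star a) (star φ))
  rwa [star_mul, c0Calculus_star, star_star, map_star, star_star] at h

theorem π_mul_c0Calculus_mul_π_mem (a : 𝒜) (φ : ZeroAtInftyContinuousMap ℝ ℂ) (b : 𝒜) :
    X.π a * c0Calculus X.isSelfAdjoint φ * X.π b ∈ X.B := by
  obtain ⟨ψ₁, ψ₂, rfl⟩ := exists_c0_factorization φ
  rw [c0Calculus_mul, ← mul_assoc, mul_assoc]
  exact mul_mem (X.π_mul_c0Calculus_mem a ψ₁) (X.c0Calculus_mul_π_mem ψ₂ b)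

theorem commF_mem (hX : X.IsUnital) (a : 𝒜) : X.commF a ∈ X.B := by
  obtain ⟨e, he⟩ := hX
  have h := X.π_mul_commF_mem e a
  rwa [he, one_mul] at h

theorem c0Calculus_mem_B (hX : X.IsUnital) (φ : ZeroAtInftyContinuousMap ℝ ℂ) :
    c0Calculus X.isSelfAdjoint φ ∈ X.B := by
  obtain ⟨e, he⟩ := hX
  have h := X.π_mul_c0Calculus_mem e φ
  rwa [he, one_mul] at h

theorem invOneAddSq_mem_B (hX : X.IsUnital) : invOneAddSq X.isSelfAdjoint ∈ X.B := by
  obtain ⟨φ, hφ⟩ := exists_c0Calculus_eq_invOneAddSq X.isSelfAdjoint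
  exact hφ ▸ X.c0Calculus_mem_B hX φ

theorem F_mul_F : X.F * X.F = 1 - invOneAddSq X.isSelfAdjoint :=
  boundedTransform_mul_self X.isSelfAdjoint

theorem star_F : star X.F = X.F := star_boundedTransform X.isSelfAdjoint

theorem commF_mul_π (a b : 𝒜) : X.commF a * X.π b = X.commF (a * b) - X.π a * X.commF b := by
  simp only [commF, map_mul, sub_mul, mul_sub, mul_assoc]
  abel

theorem F_mul_π (a : 𝒜) : X.F * X.π a = X.commF a + X.π a * X.F := by
  rw [commF, sub_add_cancel]

theorem F_mul_F_mul_mem (hX : X.IsUnital) {x : H →L[ℂ] H} (hx : x ∈ X.B) :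
    X.F * (X.F * x) ∈ X.B := by
  rw [← mul_assoc, F_mul_F, sub_mul, one_mul]
  exact sub_mem hx (mul_mem (X.invOneAddSq_mem_B hX) hx)

/-- `F` anticommutes with `[F, a]` up to `[F², a] = -[P, a]`. -/
theorem commF_mul_F (a : 𝒜) : X.commF a * X.F = -(X.F * X.commF a)
    - (invOneAddSq X.isSelfAdjoint * X.π a - X.π a * invOneAddSq X.isSelfAdjoint) := by
  have h : invOneAddSq X.isSelfAdjoint = 1 - X.F * X.F := by rw [F_mul_F, sub_sub_cancel]
  rw [h, commF]
  noncomm_ring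

theorem F_mul_π_mul_c0Calculus_mem (hX : X.IsUnital) (a : 𝒜) (φ : ZeroAtInftyContinuousMap ℝ ℂ) :
    X.F * (X.π a * c0Calculus X.isSelfAdjoint φ) ∈ X.B := by
  obtain ⟨ψ, hψ, -⟩ := exists_boundedTransform_mul_c0Calculus X.isSelfAdjoint φ
  rw [← mul_assoc, F_mul_π, add_mul, mul_assoc, F, hψ]
  exact add_mem (mul_mem (X.commF_mem hX a) (X.c0Calculus_mem_B hX φ))
    (X.π_mul_c0Calculus_mem a ψ)

theorem F_mul_π_mul_c0Calculus_mul_π_mem (hX : X.IsUnital) (a : 𝒜)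
    (φ : ZeroAtInftyContinuousMap ℝ ℂ) (b : 𝒜) :
    X.F * (X.π a * c0Calculus X.isSelfAdjoint φ * X.π b) ∈ X.B := by
  obtain ⟨ψ₁, ψ₂, rfl⟩ := exists_c0_factorization φ
  rw [c0Calculus_mul, ← mul_assoc (X.π a), mul_assoc _ _ (X.π b), ← mul_assoc X.F]
  exact mul_mem (X.F_mul_π_mul_c0Calculus_mem hX a ψ₁) (X.c0Calculus_mul_π_mem ψ₂ b)

theorem π_mul_commF_mul_F (b a : 𝒜) : X.π b * X.commF a * X.F
    = -(X.F * (X.π b * X.commF a) - X.commF b * X.commF a)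
      - (X.π b * invOneAddSq X.isSelfAdjoint * X.π a
        - X.π (b * a) * invOneAddSq X.isSelfAdjoint) := by
  rw [mul_assoc, commF_mul_F, ← mul_assoc X.F, F_mul_π, map_mul]
  noncomm_ring

theorem F_mem_idealizer (hX : X.IsUnital) : X.F ∈ X.B.idealizer := by
  obtain ⟨φ, hP⟩ := exists_c0Calculus_eq_invOneAddSq X.isSelfAdjoint
  have hl : ∀ x ∈ X.generators, X.F * x ∈ X.B := by
    rintro T (((⟨a, rfl⟩ | ⟨a, b, rfl⟩) | ⟨a, b, rfl⟩) | ⟨a, φ, rfl⟩)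
    · exact X.F_mul_F_mul_mem hX (X.commF_mem hX a)
    · exact X.F_mul_π_mul_commF_mem b a
    · rw [mul_assoc]; exact X.F_mul_F_mul_mem hX (X.π_mul_commF_mem b a)
    · exact X.F_mul_π_mul_c0Calculus_mem hX a φ
  have hbkF : ∀ b a, X.π b * X.commF a * X.F ∈ X.B ∧ X.F * (X.π b * X.commF a * X.F) ∈ X.B := by
    intro b a
    rw [π_mul_commF_mul_F, ← hP]
    refine ⟨?_, ?_⟩
    · exact sub_mem (neg_mem (sub_mem (X.F_mul_π_mul_commF_mem b a)
          (mul_mem (X.commF_mem hX b) (X.commF_mem hX a))))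
        (sub_mem (X.π_mul_c0Calculus_mul_π_mem b φ a) (X.π_mul_c0Calculus_mem (b * a) φ))
    · rw [mul_sub, mul_neg, mul_sub, mul_sub, ← mul_assoc X.F (X.commF b)]
      exact sub_mem (neg_mem (sub_mem (X.F_mul_F_mul_mem hX (X.π_mul_commF_mem b a))
          (mul_mem (X.F_mul_commF_mem b) (X.commF_mem hX a))))
        (sub_mem (X.F_mul_π_mul_c0Calculus_mul_π_mem hX b φ a)
          (X.F_mul_π_mul_c0Calculus_mem hX (b * a) φ))
  have hr : ∀ x ∈ X.generators, x * X.F ∈ X.B := by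
    rintro T (((⟨a, rfl⟩ | ⟨a, b, rfl⟩) | ⟨a, b, rfl⟩) | ⟨a, φ, rfl⟩)
    -- The generator `F [F, a]` is the case of `F b [F, a]` in which `b` represents the unit.
    · obtain ⟨e, he⟩ := hX
      have h := (hbkF e a).2
      rwa [he, one_mul, ← mul_assoc] at h
    · exact (hbkF b a).1
    · have h := (hbkF b a).2
      simpa only [mul_assoc] using h
    · obtain ⟨ψ, -, hψ⟩ := exists_boundedTransform_mul_c0Calculus X.isSelfAdjoint φ
      rw [mul_assoc, F, hψ]
      exact X.π_mul_c0Calculus_mem a ψ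
  refine NonUnitalStarSubalgebra.mem_idealizer_closure_adjoin fun x hx v hv => ?_
  have hv' : v = X.F := by
    rcases hv with rfl | rfl
    · rfl
    · exact X.star_F
  rw [hv']
  exact ⟨hl x hx, hr x hx⟩

/-- On the left, `c` is moved past `F` at the cost of `[F, c]`; on the right, the Leibniz rule for
`[F, ·]` absorbs `c`, and a term `a φ(D) c` is handled by factoring `φ`. -/
theorem π_mem_idealizer (hX : X.IsUnital) (c : 𝒜) : X.π c ∈ X.B.idealizer := by
  have hl : ∀ c, ∀ x ∈ X.generators, X.π c * x ∈ X.B := by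
    intro c
    rintro T (((⟨a, rfl⟩ | ⟨a, b, rfl⟩) | ⟨a, b, rfl⟩) | ⟨a, φ, rfl⟩)
    · have h : X.π c * (X.F * X.commF a)
          = X.F * (X.π c * X.commF a) - X.commF c * X.commF a := by
        rw [← mul_assoc X.F, F_mul_π]; noncomm_ring
      rw [h]
      exact sub_mem (X.F_mul_π_mul_commF_mem c a) (mul_mem (X.commF_mem hX c) (X.commF_mem hX a))
    · rw [← mul_assoc, ← map_mul]
      exact X.π_mul_commF_mem _ _
    · have h : X.π c * (X.F * X.π b * X.commF a)
          = X.F * (X.π (c * b) * X.commF a) - X.commF c * (X.π b * X.commF a) := by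
        rw [mul_assoc X.F, map_mul, mul_assoc (X.π c), ← mul_assoc X.F (X.π c), F_mul_π]
        noncomm_ring
      rw [h]
      exact sub_mem (X.F_mul_π_mul_commF_mem _ a)
        (mul_mem (X.commF_mem hX c) (X.π_mul_commF_mem b a))
    · rw [← mul_assoc, ← map_mul]
      exact X.π_mul_c0Calculus_mem _ φ
  have hr : ∀ c, ∀ x ∈ X.generators, x * X.π c ∈ X.B := by
    intro c
    rintro T (((⟨a, rfl⟩ | ⟨a, b, rfl⟩) | ⟨a, b, rfl⟩) | ⟨a, φ, rfl⟩)
    · rw [mul_assoc, commF_mul_π, mul_sub]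
      exact sub_mem (X.F_mul_commF_mem _) (X.F_mul_π_mul_commF_mem a c)
    · rw [mul_assoc, commF_mul_π, mul_sub, ← mul_assoc, ← map_mul]
      exact sub_mem (X.π_mul_commF_mem b _) (X.π_mul_commF_mem _ c)
    · have h : X.F * X.π b * X.commF a * X.π c
          = X.F * (X.π b * X.commF (a * c)) - X.F * (X.π (b * a) * X.commF c) := by
        rw [mul_assoc, commF_mul_π, map_mul]; noncomm_ring
      rw [h]
      exact sub_mem (X.F_mul_π_mul_commF_mem b _) (X.F_mul_π_mul_commF_mem _ c)
    · exact X.π_mul_c0Calculus_mul_π_mem a φ c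
  refine NonUnitalStarSubalgebra.mem_idealizer_closure_adjoin fun x hx v hv => ?_
  rcases hv with rfl | rfl
  · exact ⟨hl c x hx, hr c x hx⟩
  · rw [← map_star]
    exact ⟨hl _ x hx, hr _ x hx⟩

theorem mem_idealizer_of_mem_A (hX : X.IsUnital) {t : H →L[ℂ] H} (ht : t ∈ X.A) :
    t ∈ X.B.idealizer := by
  refine closure_minimal (s := (NonUnitalStarAlgHom.range X.π : Set (H →L[ℂ] H))) ?_
    (X.B.isClosed_idealizer inferInstance) ht
  intro y hy
  obtain ⟨a, rfl⟩ : ∃ a, X.π a = y := hy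
  exact X.π_mem_idealizer hX a

theorem commutator_mem_of_mem_A (hX : X.IsUnital) {t : H →L[ℂ] H} (ht : t ∈ X.A) :
    X.F * t - t * X.F ∈ X.B := by
  have hB : IsClosed (X.B : Set (H →L[ℂ] H)) := inferInstance
  have hc : Continuous fun t : H →L[ℂ] H => X.F * t - t * X.F := by fun_prop
  refine closure_minimal (s := (NonUnitalStarAlgHom.range X.π : Set (H →L[ℂ] H))) ?_
    (hB.preimage hc) ht
  intro y hy
  obtain ⟨a, rfl⟩ : ∃ a, X.π a = y := hy
  exact X.commF_mem hX a

/-- Every term on the right contains `[p, t]` or `p - p²`, which will lie in an ideal. -/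
theorem compression_star_mul_self_sub_one {R : Type*} [Ring R] {s t p : R} (h : s * t = 1) :
    (p * s * p + (1 - p)) * (p * t * p + (1 - p)) - 1
      = p * s * (p * t - t * p) * p - p * s * (p - p * p) * (t * p) + p * s * (p - p * p)
        + (p - p * p) * (t * p) - (p - p * p) - (p - p * p) - p * (p - p * p) := by
  -- Without using `h`, the two sides differ exactly by `p * (s * t - 1) * p * p`.
  have h1 : p * (s * t) * p * p = p * p * p := by rw [h, mul_one]
  rw [← sub_eq_zero, ← sub_eq_zero.mpr h1]
  noncomm_ring

/-- The inclusion of `A` into the multipliers of `B`. -/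
noncomputable def inclusionA (hX : X.IsUnital) : X.A →⋆ₙₐ[ℂ] X.B.idealizer where
  toFun a := ⟨a, X.mem_idealizer_of_mem_A hX a.2⟩
  map_smul' _ _ := rfl
  map_zero' := rfl
  map_add' _ _ := rfl
  map_mul' _ _ := rfl
  map_star' _ := rfl

/-- `p - p² = P / 4` and `[p, t] = [F, t] / 2` both lie in `B`. Only `star t * t = 1` is assumed, so
the lemma serves a unitary and its adjoint alike. -/
theorem compression_unitary_mem (hX : X.IsUnital) {t p w : H →L[ℂ] H}
    (ht : t ∈ X.A) (htt : star t * t = 1) (hp : p = (1 / 2 : ℂ) • (X.F + 1))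
    (hw : w = p * t * p + (1 - p)) (hps : star p = p) : star w * w - 1 ∈ X.B := by
  have hF := X.F_mem_idealizer hX
  have hpI : p ∈ X.B.idealizer := by
    rw [hp]; exact X.B.idealizer.smul_mem (add_mem hF (one_mem _)) _
  have htI := X.mem_idealizer_of_mem_A hX ht
  have h1 : p - p * p ∈ X.B := by
    have : p - p * p = (1 / 4 : ℂ) • invOneAddSq X.isSelfAdjoint := by
      have h : invOneAddSq X.isSelfAdjoint = 1 - X.F * X.F := by rw [F_mul_F, sub_sub_cancel]
      rw [hp, h]
      simp only [smul_mul_assoc, mul_smul_comm, add_mul, mul_add, one_mul, mul_one]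
      module
    rw [this]
    exact SMulMemClass.smul_mem _ (X.invOneAddSq_mem_B hX)
  have h2 : p * t - t * p ∈ X.B := by
    have : p * t - t * p = (1 / 2 : ℂ) • (X.F * t - t * X.F) := by
      rw [hp]
      simp only [smul_mul_assoc, mul_smul_comm, add_mul, mul_add, one_mul, mul_one]
      module
    rw [this]
    exact SMulMemClass.smul_mem _ (X.commutator_mem_of_mem_A hX ht)
  have hsI := star_mem htI
  rw [hw, star_add, star_mul, star_mul, star_sub, star_one, hps, ← mul_assoc,
    compression_star_mul_self_sub_one htt]
  have h4 := (hpI _ h1).1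
  have h5 : p * star t * (p * t - t * p) * p ∈ X.B := (hpI _ (mul_mem hpI hsI _ h2).1).2
  have h6 : p * star t * (p - p * p) ∈ X.B := (mul_mem hpI hsI _ h1).1
  have h7 := mul_mem htI hpI
  exact sub_mem (sub_mem (sub_mem (add_mem (add_mem (sub_mem h5 (h7 _ h6).2) h6) (h7 _ h1).2) h1)
    h1) h4

end VonNeumannSpectralTriple

/-! ### Transport to operators on the Hilbert module, and the main theorem. -/

namespace StarAlgHom

variable {R S : Type*} [Ring R] [StarRing R] [Algebra ℂ R] [Ring S] [StarRing S] [Algebra ℂ S]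
  (Φ : R →⋆ₐ[ℂ] S)

theorem map_mul_sq_sub_one (a F : R) : Φ a * (Φ F * Φ F - 1) = Φ (a * (F * F - 1)) := by
  simp only [map_mul, map_sub, map_one]

theorem map_mul_sub_star (a F : R) : Φ a * (Φ F - star (Φ F)) = Φ (a * (F - star F)) := by
  simp only [map_mul, map_sub, map_star]

theorem map_commutator (F a : R) : Φ F * Φ a - Φ a * Φ F = Φ (F * a - a * F) := by
  simp only [map_mul, map_sub]

theorem map_compression {F u q : R} {p w : S} (hq : q = (1 / 2 : ℂ) • (F + 1))
    (hp : p = (1 / 2 : ℂ) • (Φ F + 1)) (hw : w = p * Φ u * p + (1 - p)) :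
    w = Φ (q * u * q + (1 - q)) := by
  have h : p = Φ q := by rw [hp, hq, map_smul, map_add, map_one]
  rw [hw, h]
  simp only [map_mul, map_sub, map_one, map_add]

theorem map_star_mul_self_sub_one {v : R} {w : S} (hw : w = Φ v) :
    star w * w - 1 = Φ (star v * v - 1) ∧ w * star w - 1 = Φ (v * star v - 1) := by
  rw [hw]
  constructor <;> simp only [map_mul, map_sub, map_one, map_star]

end StarAlgHom

set_option maxHeartbeats 1600000 in
theorem mainTheorem8 {𝒜 : Type*} [NonUnitalRing 𝒜] [StarRing 𝒜] [Module ℂ 𝒜]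
    [IsScalarTower ℂ 𝒜 𝒜] [SMulCommClass ℂ 𝒜 𝒜] [StarModule ℂ 𝒜]
    {H : Type*} [NormedAddCommGroup H] [InnerProductSpace ℂ H] [CompleteSpace H]
    (N : VonNeumannAlgebra H) (J : Ideal N) (X : VonNeumannSpectralTriple 𝒜 N J)
    (hunital : X.IsUnital) (hsep : TopologicalSpace.IsSeparable (X.A : Set (H →L[ℂ] H))) :
    TopologicalSpace.IsSeparable (X.B : Set (H →L[ℂ] H)) ∧
    IsSigmaUnital X.B ∧
    (X.B : Set (H →L[ℂ] H)) ⊆ idealCarrier J ∧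
    ∃ (M : X.A →⋆ₙₐ[ℂ] RightHilbertModule.adjointable X.B X.B)
        (V : RightHilbertModule.adjointable X.B X.B),
      (∀ (a : X.A) (x : X.B), ((M a).1 x : H →L[ℂ] H) = a * x) ∧
      (∀ x : X.B, (V.1 x : H →L[ℂ] H) = X.F * x) ∧
      IsKasparovModule M V ∧
      ∀ (a : 𝒜) (u : X.A), (u : H →L[ℂ] H) = X.π a → (u : H →L[ℂ] H) ∈ unitary (H →L[ℂ] H) →
        ∀ p w : RightHilbertModule.adjointable X.B X.B,
          p = (1 / 2 : ℂ) • (V + 1) → w = p * M u * p + (1 - p) →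
          (star w * w - 1).1 ∈ RightHilbertModule.compacts X.B X.B ∧
          (w * star w - 1).1 ∈ RightHilbertModule.compacts X.B X.B := by
  have hsepB := X.isSeparable_B hsep
  have : TopologicalSpace.SeparableSpace X.B := hsepB.separableSpace
  have hσ : IsSigmaUnital X.B := isSigmaUnital_of_separable X.B
  let Φ := X.B.idealizerHom
  let F : X.B.idealizer := ⟨X.F, X.F_mem_idealizer hunital⟩
  -- Every compactness claim is reduced to the membership in `B` of an operator on `H`.
  have hcpt : ∀ {T : RightHilbertModule.adjointable X.B X.B} (t : X.B.idealizer), T = Φ t →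
      (t : H →L[ℂ] H) ∈ X.B → T.1 ∈ RightHilbertModule.compacts X.B X.B := by
    rintro _ t rfl ht
    exact X.B.idealizerHom_mem_compacts hσ ht
  have hFs : star F = F := Subtype.ext X.star_F
  let M : X.A →⋆ₙₐ[ℂ] RightHilbertModule.adjointable X.B X.B :=
    (Φ : X.B.idealizer →⋆ₙₐ[ℂ] RightHilbertModule.adjointable X.B X.B).comp (X.inclusionA hunital)
  refine ⟨hsepB, hσ, fun x hx => (X.B_le_idealStarCore hunital hx).1,
    M, Φ F, fun _ _ => rfl, fun _ => rfl, ?_, ?_⟩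
  · refine ⟨RightHilbertModule.isCountablyGenerated_self hσ, fun a => ?_, fun a => ?_, fun a => ?_⟩
    · refine hcpt _ (Φ.map_mul_sq_sub_one (X.inclusionA hunital a) F) ?_
      change (a : H →L[ℂ] H) * (X.F * X.F - 1) ∈ X.B
      rw [X.F_mul_F, sub_sub_cancel_left]
      exact (X.mem_idealizer_of_mem_A hunital a.2 _ (neg_mem (X.invOneAddSq_mem_B hunital))).1
    · refine hcpt _ (Φ.map_mul_sub_star (X.inclusionA hunital a) F) ?_
      rw [hFs, sub_self, mul_zero]
      exact zero_mem _
    · exact hcpt _ (Φ.map_commutator F (X.inclusionA hunital a))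
        (X.commutator_mem_of_mem_A hunital a.2)
  · intro a u _ hu p w hp hw
    let q : X.B.idealizer := (1 / 2 : ℂ) • (F + 1)
    let v : X.B.idealizer := q * X.inclusionA hunital u * q + (1 - q)
    have hv : w = Φ v :=
      Φ.map_compression (F := F) (u := X.inclusionA hunital u) (q := q) (p := p) rfl hp hw
    obtain ⟨hv₁, hv₂⟩ := Φ.map_star_mul_self_sub_one hv
    have hqs : star (q : H →L[ℂ] H) = q := by
      change star ((1 / 2 : ℂ) • (X.F + 1)) = (1 / 2 : ℂ) • (X.F + 1)
      rw [star_smul, star_add, star_one, X.star_F]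
      simp
    refine ⟨hcpt _ hv₁ ?_, hcpt _ hv₂ ?_⟩
    · exact X.compression_unitary_mem hunital u.2 hu.1 rfl rfl hqs
    -- The compression of `star u` is `star v`, so the lemma for `star u` controls `v * star v - 1`.
    · have h3 := X.compression_unitary_mem hunital (t := star (u : H →L[ℂ] H)) (p := q)
        (star_mem u.2) (by rw [star_star]; exact hu.2) rfl rfl hqs
      have h4 : (q : H →L[ℂ] H) * star (u : H →L[ℂ] H) * q + (1 - q) = star (v : H →L[ℂ] H) := by
        change _ = star ((q : H →L[ℂ] H) * u * q + (1 - q))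
        rw [star_add, star_mul, star_mul, star_sub, star_one, hqs, mul_assoc]
      rwa [h4, star_star] at h3
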